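/- **Setting.** Let $Q,K$ be finite signed Borel measures on $\mathbb{R}$ that are symmetric (invariant under $x\mapsto -x$) and satisfy $\int|x|\,|Q|(dx)<\infty$, $\int|x|\,|K|(dx)<\infty$. For $n\in\mathbb{Z}$ put $q_n=\int e^{inx}Q(dx)$ and $k_n=\int e^{inx}K(dx)$. For $\varepsilon>0$ let $$\Lambda(v)=-(1+\partial_x^2)^2v+\varepsilon^2v,\qquad N(v)=-v\,(Q*v)-v\,(K*v^2),$$ where $*$ is convolution in $x$. Let $C^n_b$ be the space of $n$ times continuously differentiable functions $\mathbb{R}\to\mathbb{C}$ whose derivatives of order $\le n$ are bounded, with norm $\|f\|_{C^n}=\sum_{k\le n}\sup_x|f^{(k)}(x)|$. *Mode filters.* Let $\chi_c,\chi_0\in C_c^\infty(\mathbb{R})$ be non-negative and even, with $\chi_c=1$ on $(-\tfrac98,-\tfrac78)\cup(\tfrac78,\tfrac98)$, $\chi_c=0$ outside $(-\tfrac54,-\tfrac34)\cup(\tfrac34,\tfrac54)$, $\chi_0=1$ on $(-\tfrac18,\tfrac18)$, $\chi_0=0$ outside $(-\tfrac14,\tfrac14)$. With $G_j(x)=\frac1{2\pi}\int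 e^{ikx}\chi_j(k)\,dk$ for $j\in\{c,0\}$, define $E_cv=G_c*v$, $E_0v=G_0*v$ and $E_sv=v-E_cv$. *Approximation.* Let $T_*>0$ and let $A=A(X,T)\in C([0,T_*],C^4_b)$ be complex-valued and solve on $[0,T_*]$ the Ginzburg–Landau equation $$\partial_TA=(1+4\partial_X^2)A-\Bigl(2k_0+k_2-\frac{q_1q_2}{9}-\frac{q_1^2}{9}-2q_0q_1-2q_1^2\Bigr)|A|^2A .$$ Put $A_2=-\frac{q_1}{9}A^2$ and $A_0=-2q_1|A|^2$. For an amplitude $B=B(X,T)$ write $(E_0B)(x,t)$ for the value at $x$ of $E_0$ applied to the function $y\mapsto B(\varepsilon y,\varepsilon^2t)$. Define, for $x\in\mathbb{R}$ and $t\in[0,T_*/\varepsilon^2]$, $$\phi=\varepsilon\bigl((E_0A)e^{ix}+(E_0\bar A)e^{-ix}\bigr)+\varepsilon^2\bigl((E_0A_2)e^{2ix}+(E_0\bar A_2)e^{-2ix}+E_0A_0\bigr),$$ $$\mathrm{Res}(\phi)=-\partial_t\phi+\Lambda(\phi)+N(\phi)$$ (time derivatives at the end points of the time interval are one-sided). **Proposition.**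 For every $\varepsilon_0>0$ there is a constant $C>0$ (which may depend on $Q,K,\chi_c,\chi_0,T_*,A,\varepsilon_0$, but not on $\varepsilon$) such that for all $\varepsilon\in(0,\varepsilon_0]$ the following holds. For every $t\in[0,T_*/\varepsilon^2]$ one has $\phi(\cdot,t)\in C^4_b$, $\partial_t\phi(\cdot,t)$ exists pointwise, and $\mathrm{Res}(\phi)(\cdot,t)$, $E_s\mathrm{Res}(\phi)(\cdot,t)$, $E_c\mathrm{Res}(\phi)(\cdot,t)$ belong to $C^1_b$. Moreover $$\sup_{t\in[0,T_*/\varepsilon^2]}\|E_s\mathrm{Res}(\phi)\|_{C^1}\le C\varepsilon^3\qquad\text{and}\qquad\sup_{t\in[0,T_*/\varepsilon^2]}\|E_c\mathrm{Res}(\phi)\|_{C^1}\le C\varepsilon^4 .$$ -/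

import Mathlib

open MeasureTheory Set Filter Topology
open scoped ContDiff ENNReal ComplexConjugate Convolution

noncomputable section

namespace NonlocalSwiftHohenberg

/-- The norm of `C^n_b(ℝ)`, the sum of the suprema of the derivatives of order at most `n`, as an
extended real number (so that it is `⊤` when one of the derivatives is unbounded). -/
def cnorm (n : ℕ) (f : ℝ → ℂ) : ℝ≥0∞ :=
  ∑ k ∈ Finset.range (n + 1), ⨆ x : ℝ, ‖iteratedDeriv k f x‖ₑ

/-- Membership in `C^n_b(ℝ)`. -/
def InCb (n : ℕ) (f : ℝ → ℂ) : Prop :=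
  ContDiff ℝ n f ∧ cnorm n f < ⊤

/-- Membership of the family `A T = A(·, T)` in `C([0, Tstar], C^n_b(ℝ))`. -/
def InCCb (n : ℕ) (Tstar : ℝ) (A : ℝ → ℝ → ℂ) : Prop :=
  (∀ T ∈ Icc 0 Tstar, InCb n (A T)) ∧
    ∀ S ∈ Icc 0 Tstar,
      Tendsto (fun T => cnorm n (fun X => A T X - A S X)) (𝓝[Icc 0 Tstar] S) (𝓝 0)

/-- A finite signed measure on the line which is symmetric and has a finite first absolute
moment. -/
structure IsAdmissibleKernel (Q : SignedMeasure ℝ) : Prop where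
  symm : ∀ s : Set ℝ, MeasurableSet s → Q (Neg.neg ⁻¹' s) = Q s
  moment : ∫⁻ x, ‖x‖ₑ ∂Q.totalVariation < ⊤

/-- The numbers `q_n = ∫ e^{inx} Q(dx)`. -/
def fourierCoefficient (Q : SignedMeasure ℝ) (n : ℤ) : ℂ :=
  ∫ᵛ x, Complex.exp (Complex.I * n * x) ∂<•Q

/-- The convolution `(Q ∗ f)(x) = ∫ f(x - y) Q(dy)` of a function with a signed measure. -/
def measureConv (Q : SignedMeasure ℝ) (f : ℝ → ℂ) (x : ℝ) : ℂ :=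
  ∫ᵛ y, f (x - y) ∂<•Q

/-- `v ↦ (1 + ∂ₓ²) v`. -/
def onePlusDxx (v : ℝ → ℂ) (x : ℝ) : ℂ :=
  v x + iteratedDeriv 2 v x

/-- The linear part `Λ(v) = -(1 + ∂ₓ²)² v + ε² v`. -/
def linearPart (ε : ℝ) (v : ℝ → ℂ) (x : ℝ) : ℂ :=
  -onePlusDxx (onePlusDxx v) x + (ε : ℂ) ^ 2 * v x

/-- The nonlinear part `N(v) = -v (Q ∗ v) - v (K ∗ v²)`. -/
def nonlinearPart (Q K : SignedMeasure ℝ) (v : ℝ → ℂ) (x : ℝ) : ℂ :=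
  -(v x * measureConv Q v x) - v x * measureConv K (fun y => v y ^ 2) x

/-- The coefficient of `-|A|²A` in the Ginzburg-Landau equation. -/
def cubicCoefficient (Q K : SignedMeasure ℝ) : ℂ :=
  let q := fourierCoefficient Q
  let k := fourierCoefficient K
  2 * k 0 + k 2 - q 1 * q 2 / 9 - q 1 ^ 2 / 9 - 2 * q 0 * q 1 - 2 * q 1 ^ 2

/-- `A ∈ C([0, Tstar], C⁴_b)` solves the Ginzburg-Landau equation
`∂_T A = (1 + 4 ∂_X²) A - c |A|² A` on `[0, Tstar]` (with one-sided time derivatives at the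
end points). -/
structure IsGinzburgLandauSolution (Q K : SignedMeasure ℝ) (Tstar : ℝ) (A : ℝ → ℝ → ℂ) :
    Prop where
  regular : InCCb 4 Tstar A
  equation : ∀ T ∈ Icc 0 Tstar, ∀ X : ℝ,
    HasDerivWithinAt (fun S => A S X)
      (A T X + 4 * iteratedDeriv 2 (A T) X
        - cubicCoefficient Q K * (‖A T X‖ : ℂ) ^ 2 * A T X)
      (Icc 0 Tstar) T

/-- The Fourier cut-offs around the wave numbers in the set `c`: smooth, compactly supported,
nonnegative, even, equal to `1` at distance less than `1/8` from `c` and equal to `0` except at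
distance less than `1/4` from `c`. -/
structure IsModeCutoff (c : Set ℝ) (χ : ℝ → ℝ) : Prop where
  smooth : ContDiff ℝ ∞ χ
  compact : HasCompactSupport χ
  nonneg : ∀ k, 0 ≤ χ k
  even : ∀ k, χ (-k) = χ k
  eq_one : ∀ k ∈ ⋃ a ∈ c, Metric.ball a (1 / 8), χ k = 1
  eq_zero : ∀ k ∉ ⋃ a ∈ c, Metric.ball a (1 / 4), χ k = 0

/-- The inverse Fourier transform `G(x) = (2π)⁻¹ ∫ e^{ikx} χ(k) dk` of a cut-off. -/
def modeKernel (χ : ℝ → ℝ) (x : ℝ) : ℂ :=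
  1 / (2 * Real.pi) * ∫ k : ℝ, Complex.exp (Complex.I * k * x) * (χ k : ℂ)

/-- The mode filter `E v = G ∗ v` belonging to a cut-off. -/
def modeFilter (χ : ℝ → ℝ) (v : ℝ → ℂ) : ℝ → ℂ :=
  modeKernel χ ⋆[ContinuousLinearMap.mul ℝ ℂ, volume] v

/-- The complementary filter `E_s = Id - E_c`. -/
def coFilter (χ : ℝ → ℝ) (v : ℝ → ℂ) (x : ℝ) : ℂ :=
  v x - modeFilter χ v x

/-- The second harmonic amplitude `A₂ = -(q₁/9) A²`. -/
def secondHarmonic (Q : SignedMeasure ℝ) (B : ℝ → ℂ) (X : ℝ) : ℂ :=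
  -(fourierCoefficient Q 1 / 9) * B X ^ 2

/-- The mean-mode amplitude `A₀ = -2 q₁ |A|²`. -/
def meanMode (Q : SignedMeasure ℝ) (B : ℝ → ℂ) (X : ℝ) : ℂ :=
  -2 * fourierCoefficient Q 1 * (‖B X‖ : ℂ) ^ 2

/-- The filter `E₀` acts on a slowly modulated amplitude `B` in the fast variable `x`: this is
`E₀ (B(ε ·))`. -/
def filteredAmplitude (χ₀ : ℝ → ℝ) (ε : ℝ) (B : ℝ → ℂ) : ℝ → ℂ :=
  modeFilter χ₀ (fun x => B (ε * x))

/-- The refined approximation `φ(x, t)`, written `refinedApproximation Q χ₀ ε A t x`. -/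
def refinedApproximation (Q : SignedMeasure ℝ) (χ₀ : ℝ → ℝ) (ε : ℝ) (A : ℝ → ℝ → ℂ)
    (t x : ℝ) : ℂ :=
  let B : ℝ → ℂ := A (ε ^ 2 * t)
  let E₀ : (ℝ → ℂ) → ℝ → ℂ := filteredAmplitude χ₀ ε
  let e : ℤ → ℂ := fun n => Complex.exp (Complex.I * n * x)
  ε * (E₀ B x * e 1 + E₀ (fun X => conj (B X)) x * e (-1))
    + (ε : ℂ) ^ 2 *
      (E₀ (secondHarmonic Q B) x * e 2 + E₀ (fun X => conj (secondHarmonic Q B X)) x * e (-2)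
        + E₀ (meanMode Q B) x)

/-- The residual `Res(φ) = -∂ₜ φ + Λ(φ) + N(φ)` of a function `φ` on the time interval `I` (with
one-sided time derivatives at the end points of `I`). -/
def residual (Q K : SignedMeasure ℝ) (ε : ℝ) (I : Set ℝ) (φ : ℝ → ℝ → ℂ) (t x : ℝ) : ℂ :=
  -derivWithin (fun s => φ s x) I t + linearPart ε (φ t) x + nonlinearPart Q K (φ t) x

/-- The residual `Res(φ)` of the refined approximation `φ` on the time interval
`[0, Tstar / ε²]`. -/
def approximationResidual (Q K : SignedMeasure ℝ) (χ₀ : ℝ → ℝ) (Tstar ε : ℝ) (A : ℝ → ℝ → ℂ)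
    (t x : ℝ) : ℂ :=
  residual Q K ε (Icc 0 (Tstar / ε ^ 2)) (refinedApproximation Q χ₀ ε A) t x

end NonlocalSwiftHohenberg

end

open NonlocalSwiftHohenberg

noncomputable section

namespace NonlocalSwiftHohenberg

/-! The residual is expanded in powers of `ε` and in harmonics `e^{imx}`, and two mechanisms control
it.

First, cancellation. A convolution with finite first moment acts on a slowly modulated wave `u
e^{imx}` as multiplication by its Fourier coefficient at `m`, with an error bounded by the size of
`u'`, hence `O(ε)` (`ckBound_kernelConv_mul_wave_sub`, `Modulates.conv`). The same estimate, with
coefficient `χ₀(0) = 1`, shows that `E₀` changes an amplitude only by `O(ε)` (`modulates_envelope`).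
To leading order every coefficient of the residual is therefore an algebraic expression in `A`, its
conjugate and `∂_X² A`. At order `ε²` the harmonics `±2` and `0` cancel by the choice of `A₂` and
`A₀`, because `(1 + ∂²)²` has symbol `9` and `1` there. At order `ε³` the harmonics `±1` cancel by
the Ginzburg-Landau equation. Each cancellation gains one power of `ε`.

Second, exact spectral localisation. The errors left at the harmonics `0, ±2, ±3` are only `O(ε³)`,
so `E_c` must annihilate them. Filtered amplitudes have spectrum within `1/4` of zero, and products
of up to three of them within `3/4`, while `χ_c` vanishes beyond `1/4` from `±1`; the two regions
are disjoint (`BandLimitedFamily.modeFilter_eq_zero`). Spectra are handled by duality with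
integrable functions, for which the product rule is immediate (`BandLimited.mul`).

`residual_decomposition` combines the two: noncritical harmonics of size `O(ε³)` plus a rest of size
`O(ε⁴)`. Applying `E_c` leaves only the filtered rest, and `E_s = 1 - E_c` inherits the weaker
bound.

The Schwartz kernel of `E₀` makes `φ` smooth in `x`, so `C⁴` regularity of `A` is enough even though
the `C¹` norm of a fourth order expression is estimated. Uniformity in `ε` and `t` comes from
treating pairs `(ε, t)` as the index of one family. -/

/-! ### Quantitative `C^n` bounds -/

/-- `f` is `n` times continuously differentiable, and its derivatives of order at most `n` are
bounded by `M`. -/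
def CkBound : ℕ → ℝ → (ℝ → ℂ) → Prop
  | 0, M, f => Continuous f ∧ ∀ x, ‖f x‖ ≤ M
  | n + 1, M, f => Differentiable ℝ f ∧ (∀ x, ‖f x‖ ≤ M) ∧ CkBound n M (deriv f)

namespace CkBound

variable {n : ℕ} {M M' : ℝ} {f g : ℝ → ℂ}

lemma norm_le (h : CkBound n M f) (x : ℝ) : ‖f x‖ ≤ M := by
  cases n with
  | zero => exact h.2 x
  | succ n => exact h.2.1 x

lemma continuous (h : CkBound n M f) : Continuous f := by
  cases n with
  | zero => exact h.1
  | succ n => exact h.1.continuous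

lemma nonneg (h : CkBound n M f) : 0 ≤ M := (norm_nonneg _).trans (h.norm_le 0)

lemma mono (h : CkBound n M f) (hM : M ≤ M') : CkBound n M' f := by
  induction n generalizing f with
  | zero => exact ⟨h.1, fun x => (h.2 x).trans hM⟩
  | succ n ih => exact ⟨h.1, fun x => (h.2.1 x).trans hM, ih h.2.2⟩

lemma of_succ (h : CkBound (n + 1) M f) : CkBound n M f := by
  induction n generalizing f with
  | zero => exact ⟨h.1.continuous, h.2.1⟩
  | succ n ih => exact ⟨h.1, h.2.1, ih h.2.2⟩

lemma of_le {m : ℕ} (h : CkBound n M f) (hm : m ≤ n) : CkBound m M f := by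
  induction hm with
  | refl => exact h
  | step _ ih => exact ih h.of_succ

lemma of_hasDerivAt (hf : ∀ x, HasDerivAt f (g x) x) (hb : ∀ x, ‖f x‖ ≤ M)
    (hg : CkBound n M g) : CkBound (n + 1) M f :=
  ⟨fun x => (hf x).differentiableAt, hb, by rwa [show deriv f = g from funext fun x => (hf x).deriv]⟩

lemma hasDerivAt (h : CkBound (n + 1) M f) (x : ℝ) : HasDerivAt f (deriv f x) x :=
  (h.1 x).hasDerivAt

lemma add (hf : CkBound n M f) (hg : CkBound n M' g) : CkBound n (M + M') (f + g) := by
  induction n generalizing f g with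
  | zero => exact ⟨hf.1.add hg.1, fun x => norm_add_le_of_le (hf.2 x) (hg.2 x)⟩
  | succ n ih =>
    exact of_hasDerivAt (fun x => (hf.hasDerivAt x).add (hg.hasDerivAt x))
      (fun x => norm_add_le_of_le (hf.2.1 x) (hg.2.1 x)) (ih hf.2.2 hg.2.2)

lemma const (c : ℂ) : CkBound n ‖c‖ (fun _ => c) := by
  have h0 : ∀ n, CkBound n ‖c‖ (0 : ℝ → ℂ) := by
    intro n
    induction n with
    | zero => exact ⟨continuous_const, fun x => by simp⟩
    | succ n ih => exact of_hasDerivAt (fun x => hasDerivAt_const x (0 : ℂ)) (fun x => by simp) ih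
  cases n with
  | zero => exact ⟨continuous_const, fun x => le_rfl⟩
  | succ n => exact of_hasDerivAt (fun x => hasDerivAt_const x c) (fun x => le_rfl) (h0 n)

/-- Each differentiation turns one product into two by the Leibniz rule, which doubles the constant.
-/
lemma mul (hf : CkBound n M f) (hg : CkBound n M' g) : CkBound n (2 ^ n * (M * M')) (f * g) := by
  have hb : ∀ x, ‖f x * g x‖ ≤ M * M' := fun x => by
    rw [norm_mul]
    exact mul_le_mul (hf.norm_le x) (hg.norm_le x) (norm_nonneg _) hf.nonneg
  have h0 : 0 ≤ M * M' := mul_nonneg hf.nonneg hg.nonneg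
  induction n generalizing f g with
  | zero => exact ⟨hf.1.mul hg.1, fun x => by simpa using hb x⟩
  | succ n ih =>
    refine of_hasDerivAt (fun x => (hf.hasDerivAt x).mul (hg.hasDerivAt x))
      (fun x => (hb x).trans (le_mul_of_one_le_left h0 (one_le_pow₀ (by norm_num)))) ?_
    have h1 := ih hf.2.2 hg.of_succ fun x => by
      rw [norm_mul]
      exact mul_le_mul (hf.2.2.norm_le x) (hg.norm_le x) (norm_nonneg _) hf.nonneg
    have h2 := ih hf.of_succ hg.2.2 fun x => by
      rw [norm_mul]
      exact mul_le_mul (hf.norm_le x) (hg.2.2.norm_le x) (norm_nonneg _) hf.nonneg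
    exact (h1.add h2).mono (by rw [pow_succ]; linarith)

lemma const_mul (c : ℂ) (hf : CkBound n M f) : CkBound n (‖c‖ * M) (fun x => c * f x) := by
  induction n generalizing f with
  | zero =>
    refine ⟨continuous_const.mul hf.1, fun x => ?_⟩
    rw [norm_mul]
    exact mul_le_mul_of_nonneg_left (hf.2 x) (norm_nonneg _)
  | succ n ih =>
    refine of_hasDerivAt (fun x => (hf.hasDerivAt x).const_mul c) (fun x => ?_) (ih hf.2.2)
    rw [norm_mul]
    exact mul_le_mul_of_nonneg_left (hf.2.1 x) (norm_nonneg _)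

lemma comp_conj (hf : CkBound n M f) : CkBound n M (fun x => conj (f x)) := by
  induction n generalizing f with
  | zero => exact ⟨Complex.continuous_conj.comp hf.1, fun x => by simpa using hf.2 x⟩
  | succ n ih =>
    refine of_hasDerivAt (fun x => ?_) (fun x => by simpa using hf.2.1 x) (ih hf.2.2)
    exact Complex.conjCLE.toContinuousLinearMap.hasFDerivAt.comp_hasDerivAt x (hf.hasDerivAt x)

lemma comp_mul_left {r r₀ : ℝ} (hr : |r| ≤ r₀) (hr₀ : 1 ≤ r₀) (hf : CkBound n M f) :
    CkBound n (r₀ ^ n * M) (fun x => f (r * x)) := by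
  induction n generalizing f with
  | zero =>
    exact ⟨hf.1.comp (continuous_const.mul continuous_id), fun x => by simpa using hf.2 (r * x)⟩
  | succ n ih =>
    refine of_hasDerivAt (g := fun x => (r : ℂ) * deriv f (r * x)) (fun x => ?_) (fun x => ?_) ?_
    · have h := (hf.hasDerivAt (r * x)).scomp x ((hasDerivAt_id x).const_mul r)
      simpa [Function.comp_def] using h
    · exact (hf.2.1 _).trans (le_mul_of_one_le_left hf.nonneg (one_le_pow₀ hr₀))
    · refine ((ih hf.2.2).const_mul (r : ℂ)).mono ?_
      rw [pow_succ', mul_assoc, Complex.norm_real, Real.norm_eq_abs]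
      exact mul_le_mul_of_nonneg_right hr (mul_nonneg (by positivity) hf.nonneg)

lemma contDiff (hf : CkBound n M f) : ContDiff ℝ n f := by
  induction n generalizing f with
  | zero => exact contDiff_zero.2 hf.1
  | succ n ih =>
    push_cast
    exact contDiff_succ_iff_deriv.2 ⟨hf.1, by simp, ih hf.2.2⟩

lemma norm_iteratedDeriv_le (hf : CkBound n M f) {k : ℕ} (hk : k ≤ n) (x : ℝ) :
    ‖iteratedDeriv k f x‖ ≤ M := by
  induction n generalizing f k with
  | zero =>
    obtain rfl : k = 0 := by omega
    simpa using hf.2 x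
  | succ n ih =>
    cases k with
    | zero => simpa using hf.2.1 x
    | succ k => rw [iteratedDeriv_succ']; exact ih hf.2.2 (by omega)

lemma of_iteratedDeriv (hf : ContDiff ℝ n f)
    (hb : ∀ k ≤ n, ∀ x, ‖iteratedDeriv k f x‖ ≤ M) : CkBound n M f := by
  induction n generalizing f with
  | zero => exact ⟨hf.continuous, fun x => by simpa using hb 0 le_rfl x⟩
  | succ n ih =>
    have h := (contDiff_succ_iff_deriv (𝕜 := ℝ) (n := n)).1 (by exact_mod_cast hf)
    exact ⟨h.1, fun x => by simpa using hb 0 (by omega) x, ih h.2.2 fun k hk x => by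
      rw [← iteratedDeriv_succ']; exact hb (k + 1) (by omega) x⟩

lemma cnorm_le (hf : CkBound n M f) : cnorm n f ≤ ENNReal.ofReal ((n + 1) * M) := by
  have h : cnorm n f ≤ ∑ _k ∈ Finset.range (n + 1), ENNReal.ofReal M := by
    refine Finset.sum_le_sum fun k hk => iSup_le fun x => ?_
    rw [← ofReal_norm]
    exact ENNReal.ofReal_le_ofReal
      (hf.norm_iteratedDeriv_le (by have := Finset.mem_range.1 hk; omega) x)
  refine h.trans (le_of_eq ?_)
  rw [Finset.sum_const, Finset.card_range, nsmul_eq_mul, ENNReal.ofReal_mul (by positivity)]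
  congr 1
  exact_mod_cast (ENNReal.ofReal_natCast (n + 1)).symm

lemma inCb (hf : CkBound n M f) : InCb n f :=
  ⟨hf.contDiff, hf.cnorm_le.trans_lt ENNReal.ofReal_lt_top⟩

lemma iteratedDeriv (hf : CkBound n M f) {k m : ℕ} (h : k + m ≤ n) :
    CkBound m M (iteratedDeriv k f) := by
  induction k generalizing n f with
  | zero => simpa using hf.of_le (by omega : m ≤ n)
  | succ k ih =>
    obtain ⟨n, rfl⟩ : ∃ n', n = n' + 1 := ⟨n - 1, by omega⟩
    rw [iteratedDeriv_succ']
    exact ih hf.2.2 (by omega)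

end CkBound

lemma norm_iteratedDeriv_le_cnorm {n k : ℕ} (hk : k ≤ n) (f : ℝ → ℂ) (x : ℝ) :
    ‖iteratedDeriv k f x‖ₑ ≤ cnorm n f :=
  (le_iSup (fun x => ‖iteratedDeriv k f x‖ₑ) x).trans
    (Finset.single_le_sum (f := fun k => ⨆ x : ℝ, ‖iteratedDeriv k f x‖ₑ) (fun _ _ => zero_le)
      (Finset.mem_range.2 (by omega)))

lemma InCb.ckBound {n : ℕ} {f : ℝ → ℂ} (hf : InCb n f) : CkBound n (cnorm n f).toReal f := by
  refine CkBound.of_iteratedDeriv hf.1 fun k hk x => ?_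
  rw [← toReal_enorm]
  exact ENNReal.toReal_mono hf.2.ne (norm_iteratedDeriv_le_cnorm hk f x)

/-- A continuous family in `C^n_b` over a compact interval is uniformly bounded. -/
lemma InCCb.exists_ckBound {n : ℕ} {Tstar : ℝ} {A : ℝ → ℝ → ℂ} (hA : InCCb n Tstar A) :
    ∃ M, ∀ T ∈ Icc 0 Tstar, CkBound n M (A T) := by
  have h := isCompact_Icc.induction_on (s := Icc 0 Tstar)
    (p := fun s => ∃ M, ∀ T ∈ s ∩ Icc 0 Tstar, CkBound n M (A T))
    ⟨0, fun T hT => absurd hT.1 (notMem_empty T)⟩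
    (fun s t hst ⟨M, hM⟩ => ⟨M, fun T hT => hM T ⟨hst hT.1, hT.2⟩⟩)
    (fun s t ⟨M, hM⟩ ⟨M', hM'⟩ => ⟨max M M', fun T hT => hT.1.elim
      (fun h => (hM T ⟨h, hT.2⟩).mono (le_max_left _ _))
      (fun h => (hM' T ⟨h, hT.2⟩).mono (le_max_right _ _))⟩)
    (fun S hS => by
      -- Near `S` the family stays within distance `1` of `A S`; compactness of the interval makes
      -- these local bounds uniform.
      refine ⟨{T | T ∈ Icc 0 Tstar ∧ cnorm n (fun X => A T X - A S X) < 1}, ?_,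
        1 + (cnorm n (A S)).toReal, fun T hT => ?_⟩
      · exact Filter.Eventually.and self_mem_nhdsWithin
          ((hA.2 S hS).eventually_lt_const (by norm_num))
      · have h1 : InCb n (fun X => A T X - A S X) :=
          ⟨(hA.1 T hT.2).1.sub (hA.1 S hS).1, hT.1.2.trans (by norm_num)⟩
        have h2 := (h1.ckBound.mono (M' := 1) (by
          rw [← ENNReal.toReal_one]
          exact ENNReal.toReal_mono (by norm_num) hT.1.2.le)).add (hA.1 S hS).ckBound
        convert h2 using 1
        ext X
        simp)
  obtain ⟨M, hM⟩ := h
  exact ⟨M, fun T hT => hM T ⟨hT, hT⟩⟩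

/-! ### Convolution with an integrable density -/

/-- The convolution of `f` with the complex measure `k μ`. -/
def kernelConv (μ : Measure ℝ) (k : ℝ → ℂ) (f : ℝ → ℂ) (x : ℝ) : ℂ :=
  ∫ y, k y * f (x - y) ∂μ

/-- The plane wave `x ↦ e^{imx}`. -/
def wave (m : ℤ) (x : ℝ) : ℂ := Complex.exp (Complex.I * m * x)

lemma norm_wave (m : ℤ) (x : ℝ) : ‖wave m x‖ = 1 := by
  rw [wave, show Complex.I * m * x = ((m * x : ℝ) : ℂ) * Complex.I by push_cast; ring]
  exact Complex.norm_exp_ofReal_mul_I _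

lemma wave_zero : wave 0 = 1 := by
  ext x
  simp [wave]

lemma wave_add (m n : ℤ) : wave (m + n) = wave m * wave n := by
  ext x
  simp only [wave, Pi.mul_apply, ← Complex.exp_add]
  congr 1
  push_cast
  ring

lemma wave_sub_apply (m : ℤ) (x y : ℝ) :
    wave m (x - y) = Complex.exp (-(Complex.I * m * y)) * wave m x := by
  simp only [wave, ← Complex.exp_add]
  congr 1
  push_cast
  ring

lemma hasDerivAt_wave (m : ℤ) (x : ℝ) : HasDerivAt (wave m) (Complex.I * m * wave m x) x := by
  have h : HasDerivAt (fun x : ℝ => Complex.I * m * (x : ℂ)) (Complex.I * m) x := by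
    simpa using (Complex.ofRealCLM.hasDerivAt (x := x)).const_mul (Complex.I * m)
  exact h.cexp.congr_deriv (mul_comm _ _)

lemma exists_ckBound_wave (n : ℕ) (m : ℤ) : ∃ M, CkBound n M (wave m) := by
  induction n with
  | zero =>
    exact ⟨1, continuous_iff_continuousAt.2 fun x => (hasDerivAt_wave m x).continuousAt,
      fun x => (norm_wave m x).le⟩
  | succ n ih =>
    obtain ⟨M, hM⟩ := ih
    refine ⟨max 1 _, CkBound.of_hasDerivAt (hasDerivAt_wave m)
      (fun x => (norm_wave m x).le.trans (le_max_left _ _))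
      ((hM.const_mul (Complex.I * m)).mono (le_max_right _ _))⟩

section kernelConv

variable {μ : Measure ℝ} {k : ℝ → ℂ} {f g : ℝ → ℂ} {n : ℕ} {M M' : ℝ}

lemma integrable_kernelConv (hk : Integrable k μ) (hf : CkBound 0 M f) (x : ℝ) :
    Integrable (fun y => k y * f (x - y)) μ :=
  hk.mul_bdd (hf.continuous.comp (continuous_const.sub continuous_id)).aestronglyMeasurable
    (Eventually.of_forall fun y => hf.norm_le (x - y))

lemma kernelConv_add (hk : Integrable k μ) (hf : CkBound 0 M f) (hg : CkBound 0 M' g) :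
    kernelConv μ k (f + g) = kernelConv μ k f + kernelConv μ k g := by
  ext x
  simp only [kernelConv, Pi.add_apply, mul_add]
  exact integral_add (integrable_kernelConv hk hf x) (integrable_kernelConv hk hg x)

lemma kernelConv_const_mul (c : ℂ) (f : ℝ → ℂ) :
    kernelConv μ k (fun x => c * f x) = fun x => c * kernelConv μ k f x := by
  ext x
  simp only [kernelConv, ← integral_const_mul]
  congr 1
  ext y
  ring

lemma norm_kernelConv_le (hk : Integrable k μ) (hf : CkBound 0 M f) (x : ℝ) :
    ‖kernelConv μ k f x‖ ≤ (∫ y, ‖k y‖ ∂μ) * M := by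
  rw [← integral_mul_const]
  refine norm_integral_le_of_norm_le (hk.norm.mul_const M) (Eventually.of_forall fun y => ?_)
  rw [norm_mul]
  exact mul_le_mul_of_nonneg_left (hf.norm_le _) (norm_nonneg _)

lemma continuous_kernelConv (hk : Integrable k μ) (hf : CkBound 0 M f) :
    Continuous (kernelConv μ k f) := by
  refine continuous_of_dominated (bound := fun y => ‖k y‖ * M)
    (fun x => (integrable_kernelConv hk hf x).aestronglyMeasurable)
    (fun x => Eventually.of_forall fun y => ?_) (hk.norm.mul_const M)
    (Eventually.of_forall fun y => continuous_const.mul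
      (hf.continuous.comp (continuous_id.sub continuous_const)))
  rw [norm_mul]
  exact mul_le_mul_of_nonneg_left (hf.norm_le _) (norm_nonneg _)

lemma hasDerivAt_kernelConv (hk : Integrable k μ) (hf : CkBound 1 M f) (x : ℝ) :
    HasDerivAt (kernelConv μ k f) (kernelConv μ k (deriv f) x) x := by
  refine (hasDerivAt_integral_of_dominated_loc_of_deriv_le (bound := fun y => ‖k y‖ * M)
    (F' := fun x y => k y * deriv f (x - y)) univ_mem
    (Eventually.of_forall fun x =>
      (integrable_kernelConv hk (hf.of_le zero_le_one) x).aestronglyMeasurable)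
    (integrable_kernelConv hk (hf.of_le zero_le_one) x)
    (integrable_kernelConv hk hf.2.2 x).aestronglyMeasurable
    (Eventually.of_forall fun y x _ => ?_) (hk.norm.mul_const M)
    (Eventually.of_forall fun y x _ => ?_)).2
  · rw [norm_mul]
    exact mul_le_mul_of_nonneg_left (hf.2.2.norm_le _) (norm_nonneg _)
  · exact ((hf.hasDerivAt (x - y)).comp_sub_const x y).const_mul (k y)

lemma CkBound.kernelConv (hk : Integrable k μ) (hf : CkBound n M f) :
    CkBound n ((∫ y, ‖k y‖ ∂μ) * M) (kernelConv μ k f) := by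
  induction n generalizing f with
  | zero => exact ⟨continuous_kernelConv hk hf, norm_kernelConv_le hk hf⟩
  | succ n ih =>
    exact of_hasDerivAt (hasDerivAt_kernelConv hk (hf.of_le (by omega)))
      (norm_kernelConv_le hk (hf.of_le (by omega))) (ih hf.2.2)

/-- The Fourier coefficient `∫ e^{-imy} k(y) μ(dy)` of the complex measure `k μ`. -/
def kernelCoeff (μ : Measure ℝ) (k : ℝ → ℂ) (m : ℤ) : ℂ :=
  ∫ y, k y * Complex.exp (-(Complex.I * m * y)) ∂μ

lemma norm_exp_neg_I_mul (m : ℤ) (y : ℝ) : ‖Complex.exp (-(Complex.I * m * y))‖ = 1 := by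
  rw [show -(Complex.I * m * y) = ((-(m * y) : ℝ) : ℂ) * Complex.I by push_cast; ring]
  exact Complex.norm_exp_ofReal_mul_I _

lemma integrable_kernelCoeff (hk : Integrable k μ) (m : ℤ) :
    Integrable (fun y : ℝ => k y * Complex.exp (-(Complex.I * m * y))) μ :=
  hk.mul_bdd (c := 1) (by fun_prop) (Eventually.of_forall fun y => (norm_exp_neg_I_mul m y).le)

lemma norm_kernelCoeff_le (hk : Integrable k μ) (m : ℤ) :
    ‖kernelCoeff μ k m‖ ≤ ∫ y, ‖k y‖ ∂μ :=
  norm_integral_le_of_norm_le hk.norm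
    (Eventually.of_forall fun y => by rw [norm_mul, norm_exp_neg_I_mul, mul_one])

/-- A convolution acts on a slowly modulated plane wave as multiplication by a Fourier
coefficient, up to the size of the derivative of the amplitude. -/
lemma norm_kernelConv_mul_wave_sub_le (hk : Integrable k μ)
    (hk1 : Integrable (fun y => ‖y‖ * ‖k y‖) μ) (hf : CkBound 1 M f) (hδ : CkBound 0 M' (deriv f))
    (m : ℤ) (x : ℝ) :
    ‖kernelConv μ k (f * wave m) x - kernelCoeff μ k m * (f x * wave m x)‖ ≤
      (∫ y, ‖y‖ * ‖k y‖ ∂μ) * M' := by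
  obtain ⟨W, hW⟩ := exists_ckBound_wave 0 m
  have h1 := integrable_kernelConv hk ((hf.of_le zero_le_one).mul hW) x
  rw [kernelConv, kernelCoeff, ← integral_mul_const,
    ← integral_sub h1 ((integrable_kernelCoeff hk m).mul_const _), ← integral_mul_const]
  refine norm_integral_le_of_norm_le (hk1.mul_const M') (Eventually.of_forall fun y => ?_)
  -- Mean value inequality: shifting the amplitude by `y` costs `M' |y|`, which the first moment of
  -- the kernel absorbs.
  have h2 : ‖f (x - y) - f x‖ ≤ M' * ‖(x - y) - x‖ :=
    convex_univ.norm_image_sub_le_of_norm_hasDerivWithin_le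
      (fun z _ => (hf.hasDerivAt z).hasDerivWithinAt) (fun z _ => hδ.norm_le z)
      (mem_univ _) (mem_univ _)
  rw [sub_sub_cancel_left, norm_neg] at h2
  have h3 : k y * (f * wave m) (x - y) - k y * Complex.exp (-(Complex.I * m * y)) *
      (f x * wave m x) = k y * (f (x - y) - f x) * Complex.exp (-(Complex.I * m * y)) *
        wave m x := by
    simp only [Pi.mul_apply, wave_sub_apply]
    ring
  rw [h3, norm_mul, norm_mul, norm_mul, norm_wave, norm_exp_neg_I_mul, mul_one, mul_one]
  calc ‖k y‖ * ‖f (x - y) - f x‖ ≤ ‖k y‖ * (M' * ‖y‖) :=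
        mul_le_mul_of_nonneg_left h2 (norm_nonneg _)
    _ = _ := by ring

/-- The `C¹` bound needs no second derivative of the amplitude: differentiating the error `R`
reproduces `im R`, plus the convolution and the multiplication applied to `f' e^{imx}`. These last
two are already of size `M'`, without using any cancellation between them. -/
lemma ckBound_kernelConv_mul_wave_sub (hk : Integrable k μ)
    (hk1 : Integrable (fun y => ‖y‖ * ‖k y‖) μ) (m : ℤ) :
    ∃ C, ∀ M M' f, CkBound 1 M f → CkBound 0 M' (deriv f) →
      CkBound 1 (C * M')
        (fun x => kernelConv μ k (f * wave m) x - kernelCoeff μ k m * (f x * wave m x)) := by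
  set N := ∫ y, ‖k y‖ ∂μ
  set N₁ := ∫ y, ‖y‖ * ‖k y‖ ∂μ
  have hN : 0 ≤ N := integral_nonneg fun y => norm_nonneg _
  have hN₁ : 0 ≤ N₁ := integral_nonneg fun y => mul_nonneg (norm_nonneg _) (norm_nonneg _)
  -- One `N` bounds the convolution of `f' e^{imx}`, the other its multiple by the Fourier
  -- coefficient; `N₁` bounds `R` and `‖im‖ N₁` the term `im R`.
  refine ⟨N + N + (1 + ‖Complex.I * m‖) * N₁, fun M M' f hf hδ => ?_⟩
  have hM' := hδ.nonneg
  obtain ⟨W, hW⟩ := exists_ckBound_wave 1 m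
  have hD : ∀ x, HasDerivAt (f * wave m)
      ((deriv f * wave m) x + Complex.I * m * (f * wave m) x) x := fun x => by
    refine ((hf.hasDerivAt x).mul (hasDerivAt_wave m x)).congr_deriv ?_
    simp only [Pi.mul_apply]
    ring
  have hfw := hf.mul hW
  have hdw : CkBound 0 M' (deriv f * wave m) :=
    ⟨(hδ.mul (hW.of_le zero_le_one)).continuous, fun x => by
      rw [Pi.mul_apply, norm_mul, norm_wave, mul_one]; exact hδ.norm_le x⟩
  have hder : deriv (f * wave m) = deriv f * wave m + fun x => Complex.I * m * (f * wave m) x :=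
    funext fun x => (hD x).deriv
  set R := fun x => kernelConv μ k (f * wave m) x - kernelCoeff μ k m * (f x * wave m x)
  have hR : ∀ x, ‖R x‖ ≤ N₁ * M' := fun x => norm_kernelConv_mul_wave_sub_le hk hk1 hf hδ m x
  have hR' : ∀ x, HasDerivAt R
      ((kernelConv μ k (deriv f * wave m) + fun x => -kernelCoeff μ k m * (deriv f * wave m) x) x +
        Complex.I * m * R x) x := fun x => by
    refine ((hasDerivAt_kernelConv hk hfw x).sub
      ((hD x).const_mul (kernelCoeff μ k m))).congr_deriv ?_
    rw [hder, kernelConv_add hk hdw (((hfw.of_le zero_le_one).const_mul _)), kernelConv_const_mul]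
    simp only [Pi.add_apply, Pi.mul_apply, R]
    ring
  refine CkBound.of_hasDerivAt hR' (fun x => (hR x).trans ?_) ?_
  · gcongr
    nlinarith [norm_nonneg (Complex.I * (m : ℂ))]
  · have hRc : Continuous R := continuous_iff_continuousAt.2 fun x => (hR' x).continuousAt
    have h0 : CkBound 0 (N₁ * M') R := ⟨hRc, hR⟩
    refine (((hdw.kernelConv hk).add (hdw.const_mul (-kernelCoeff μ k m))).add
      (h0.const_mul (Complex.I * m))).mono ?_
    rw [norm_neg]
    have := mul_le_mul_of_nonneg_right (norm_kernelCoeff_le (μ := μ) hk m) hM'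
    have := mul_nonneg hN₁ hM'
    change N * M' + _ + _ ≤ _
    nlinarith

end kernelConv

/-! ### Signed measures as densities -/

/-- The polar decomposition of a signed measure with respect to its total variation. -/
lemma exists_sign_density (Q : SignedMeasure ℝ) :
    ∃ h : ℝ → ℂ, Measurable h ∧ (∀ x, ‖h x‖ ≤ 1) ∧ (∀ x, conj (h x) = h x) ∧
      ∀ M f, CkBound 0 M f → ∫ᵛ x, f x ∂<•Q = ∫ x, h x * f x ∂Q.totalVariation := by
  classical
  -- The Hahn set `s` is null for the positive part and its complement for the negative part, so the
  -- density is `-1` on `s` and `1` off it.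
  obtain ⟨s, hs, hpos, hneg⟩ := Q.toJordanDecomposition.mutuallySingular
  set P := Q.toJordanDecomposition.posPart
  set N := Q.toJordanDecomposition.negPart
  have hm : Measurable (fun x : ℝ => if x ∈ s then (-1 : ℂ) else 1) :=
    Measurable.ite hs measurable_const measurable_const
  refine ⟨fun x => if x ∈ s then -1 else 1, hm, fun x => by dsimp only; split_ifs <;> simp,
    fun x => by dsimp only; split_ifs <;> simp, fun M f hf => ?_⟩
  have hi : ∀ ν : Measure ℝ, IsFiniteMeasure ν → Integrable f ν := fun ν _ =>
    Integrable.of_bound hf.continuous.aestronglyMeasurable M (Eventually.of_forall hf.norm_le)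
  have hi' : ∀ ν : Measure ℝ, IsFiniteMeasure ν →
      Integrable (fun x => (if x ∈ s then (-1 : ℂ) else 1) * f x) ν := fun ν _ =>
    (hi ν ‹_›).bdd_mul (c := 1) hm.aestronglyMeasurable
      (Eventually.of_forall fun x => by split_ifs <;> simp)
  have hvi : ∀ ν : Measure ℝ, ∀ _ : IsFiniteMeasure ν,
      VectorMeasure.Integrable ν.toSignedMeasure f := by
    intro ν hν
    rw [VectorMeasure.Integrable, ← SignedMeasure.totalVariation_eq_variation]
    exact hi _ (by infer_instance)
  have hQ : Q = P.toSignedMeasure - N.toSignedMeasure :=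
    Q.toSignedMeasure_toJordanDecomposition.symm
  have hP : ∫ x, (if x ∈ s then (-1 : ℂ) else 1) * f x ∂P = ∫ x, f x ∂P := by
    refine integral_congr_ae ?_
    filter_upwards [compl_mem_ae_iff.2 hpos] with x hx
    rw [if_neg hx, one_mul]
  have hN : ∫ x, (if x ∈ s then (-1 : ℂ) else 1) * f x ∂N = -∫ x, f x ∂N := by
    rw [← integral_neg]
    refine integral_congr_ae ?_
    filter_upwards [mem_ae_iff.2 hneg] with x hx
    rw [if_pos hx, neg_one_mul]
  rw [SignedMeasure.totalVariation, integral_add_measure (hi' _ inferInstance) (hi' _ inferInstance),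
    hP, hN]
  conv_lhs => rw [hQ]
  rw [VectorMeasure.integral_sub_vectorMeasure (hvi _ inferInstance) (hvi _ inferInstance),
    VectorMeasure.integral_toSignedMeasure, VectorMeasure.integral_toSignedMeasure, sub_eq_add_neg]

/-- A signed measure acts on bounded continuous functions as an integrable density with finite
first moment and real, even Fourier coefficients. -/
lemma IsAdmissibleKernel.exists_density {Q : SignedMeasure ℝ} (hQ : IsAdmissibleKernel Q) :
    ∃ h : ℝ → ℂ, Integrable h Q.totalVariation ∧
      Integrable (fun y => ‖y‖ * ‖h y‖) Q.totalVariation ∧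
      (∀ M f, CkBound 0 M f → measureConv Q f = kernelConv Q.totalVariation h f) ∧
      (∀ m, fourierCoefficient Q m = kernelCoeff Q.totalVariation h m) ∧
      (∀ m, fourierCoefficient Q (-m) = fourierCoefficient Q m) ∧
      ∀ m, conj (fourierCoefficient Q m) = fourierCoefficient Q m := by
  obtain ⟨h, hm, hb, hc, hint⟩ := exists_sign_density Q
  have hcb : ∀ m : ℤ, ∃ M, CkBound 0 M (fun x : ℝ => Complex.exp (Complex.I * m * x)) :=
    fun m => exists_ckBound_wave 0 m
  have hmap : Q.map (MeasurableEquiv.neg ℝ) = Q := by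
    ext s hs
    rw [VectorMeasure.map_apply _ (MeasurableEquiv.neg ℝ).measurable hs]
    exact hQ.symm s hs
  have heven : ∀ m, fourierCoefficient Q (-m) = fourierCoefficient Q m := fun m => by
    have h1 := VectorMeasure.integral_map_equiv (μ := Q)
      (B := (ContinuousLinearMap.lsmul ℝ ℝ (E := ℂ)).flip) (MeasurableEquiv.neg ℝ)
      (fun x : ℝ => Complex.exp (Complex.I * m * x))
    rw [hmap] at h1
    simp only [fourierCoefficient]
    rw [h1]
    congr 1
    ext x
    simp
  have hcoef : ∀ m, fourierCoefficient Q m = kernelCoeff Q.totalVariation h m := fun m => by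
    obtain ⟨M, hM⟩ := hcb (-m)
    -- The two coefficients use opposite signs in the exponent; the symmetry of `Q` identifies them.
    rw [← heven, fourierCoefficient, hint M _ hM, kernelCoeff]
    congr 1
    ext x
    push_cast
    ring_nf
  refine ⟨h, Integrable.of_bound hm.aestronglyMeasurable 1 (Eventually.of_forall hb), ?_,
    fun M f hf => ?_, hcoef, heven, fun m => ?_⟩
  · have h1 : Integrable (fun y : ℝ => y) Q.totalVariation :=
      ⟨measurable_id.aestronglyMeasurable, hQ.moment⟩
    refine h1.norm.mul_bdd (c := 1) hm.norm.aestronglyMeasurable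
      (Eventually.of_forall fun y => by simpa using hb y)
  · ext x
    exact hint M (fun y => f (x - y))
      ⟨hf.continuous.comp (continuous_const.sub continuous_id), fun y => hf.norm_le (x - y)⟩
  -- The density is real, so conjugation only reverses the frequency, and evenness undoes this.
  · rw [← heven]
    nth_rw 1 [heven]
    rw [hcoef, hcoef, kernelCoeff, kernelCoeff, ← integral_conj]
    congr 1
    ext x
    rw [map_mul, hc, ← Complex.exp_conj]
    simp

/-! ### The mode kernels -/

open scoped SchwartzMap FourierTransform

/-- The kernel of a mode filter is a Schwartz function with Fourier transform the cut-off. -/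
lemma IsModeCutoff.exists_schwartz {c : Set ℝ} {χ : ℝ → ℝ} (hχ : IsModeCutoff c χ) :
    ∃ G : 𝓢(ℝ, ℂ), modeKernel χ = G ∧
      ∀ l : ℝ, ∫ y, G y * Complex.exp (-(Complex.I * l * y)) = χ l := by
  have hpi : (2 * Real.pi) ≠ 0 := by positivity
  have hcs : HasCompactSupport (fun v : ℝ => (χ (2 * Real.pi * v) : ℂ)) := by
    have h1 : HasCompactSupport (fun v : ℝ => χ (2 * Real.pi * v)) :=
      hχ.compact.comp_homeomorph (Homeomorph.mulLeft₀ (2 * Real.pi) hpi)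
    exact h1.comp_left (g := Complex.ofReal) Complex.ofReal_zero
  have hsm : ContDiff ℝ ∞ (fun v : ℝ => (χ (2 * Real.pi * v) : ℂ)) :=
    Complex.ofRealCLM.contDiff.comp (hχ.smooth.comp (contDiff_const.mul contDiff_id))
  -- The rescaling by `2π` converts between the kernels `e^{ikx}` and `e^{2πivx}`.
  set S : 𝓢(ℝ, ℂ) := hcs.toSchwartzMap hsm with hS
  have hSv : ∀ v, S v = (χ (2 * Real.pi * v) : ℂ) := fun v => rfl
  refine ⟨𝓕⁻ S, ?_, fun l => ?_⟩
  · ext x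
    rw [SchwartzMap.fourierInv_coe, Real.fourierInv_eq', modeKernel]
    have h := Measure.integral_comp_mul_left
      (fun k : ℝ => Complex.exp (Complex.I * k * x) * (χ k : ℂ)) (2 * Real.pi)
    rw [abs_of_pos (by positivity)] at h
    have h2 : (1 / (2 * (Real.pi : ℂ))) * ∫ k : ℝ, Complex.exp (Complex.I * k * x) * (χ k : ℂ)
        = (2 * Real.pi)⁻¹ • ∫ k : ℝ, Complex.exp (Complex.I * k * x) * (χ k : ℂ) := by
      rw [Complex.real_smul]
      push_cast
      rw [one_div]
    rw [h2, ← h]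
    congr 1
    ext v
    rw [hSv, smul_eq_mul]
    congr 2
    simp
    ring
  · have h : 𝓕 (𝓕⁻ S) (l / (2 * Real.pi)) = (χ l : ℂ) := by
      rw [FourierTransform.fourier_fourierInv_eq, hSv]
      congr 2
      field_simp
    rw [← h, SchwartzMap.fourier_coe, Real.fourier_real_eq_integral_exp_smul]
    congr 1
    ext y
    rw [smul_eq_mul, mul_comm]
    congr 2
    push_cast
    field_simp

/-! ### Smoothing by Schwartz kernels -/

lemma kernelConv_volume (k f : ℝ → ℂ) (x : ℝ) :
    kernelConv volume k f x = ∫ y, k (x - y) * f y := by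
  have h := integral_sub_left_eq_self (fun y => k (x - y) * f y) volume x
  rw [← h, kernelConv]
  simp only [sub_sub_cancel]

/-- Here the derivative falls on the kernel, so `f` need only be bounded and continuous. The
quadratic decay of `G'` supplies a dominating function that is locally uniform in `x`. -/
lemma hasDerivAt_kernelConv_schwartz (G : 𝓢(ℝ, ℂ)) {f : ℝ → ℂ} {M : ℝ} (hf : CkBound 0 M f)
    (x₀ : ℝ) :
    HasDerivAt (kernelConv volume G f)
      (kernelConv volume (SchwartzMap.derivCLM ℂ ℂ G) f x₀) x₀ := by
  set D := SchwartzMap.derivCLM ℂ ℂ G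
  have hD : ∀ z, HasDerivAt G (D z) z := fun z => G.hasDerivAt z
  obtain ⟨C, hC⟩ : ∃ C : ℝ, ∀ z, ‖D z‖ ≤ C * (1 + z ^ 2)⁻¹ := by
    refine ⟨SchwartzMap.seminorm ℂ 0 0 D + SchwartzMap.seminorm ℂ 2 0 D, fun z => ?_⟩
    rw [← div_eq_mul_inv, le_div_iff₀ (by positivity)]
    have h1 := SchwartzMap.norm_le_seminorm ℂ D z
    have h2 := SchwartzMap.norm_pow_mul_le_seminorm ℂ D 2 z
    rw [Real.norm_eq_abs, sq_abs] at h2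
    linarith
  have hC0 : 0 ≤ C := by simpa using (norm_nonneg _).trans (hC 0)
  have hint : ∀ (H : 𝓢(ℝ, ℂ)) (x : ℝ), Integrable (fun y => H (x - y) * f y) := fun H x =>
    (H.integrable.comp_sub_left x).mul_bdd hf.continuous.aestronglyMeasurable
      (Eventually.of_forall hf.norm_le)
  rw [show kernelConv volume G f = fun x => ∫ y, G (x - y) * f y from
    funext fun x => kernelConv_volume _ _ x, kernelConv_volume]
  refine (hasDerivAt_integral_of_dominated_loc_of_deriv_le
    (bound := fun y => (C * 3) * (1 + (x₀ - y) ^ 2)⁻¹ * M)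
    (F' := fun x y => D (x - y) * f y) (Metric.ball_mem_nhds x₀ one_pos)
    (Eventually.of_forall fun x => (hint G x).aestronglyMeasurable) (hint G x₀)
    (hint D x₀).aestronglyMeasurable
    (Eventually.of_forall fun y x hx => ?_) ?_
    (Eventually.of_forall fun y x _ => ?_)).2
  · rw [norm_mul]
    refine mul_le_mul ((hC _).trans ?_) (hf.norm_le y) (norm_nonneg _) (by positivity)
    rw [mul_assoc]
    refine mul_le_mul_of_nonneg_left ?_ hC0
    -- The factor `3` comes from `1 + (x₀ - y)² ≤ 1 + 2 (x - y)² + 2 (x - x₀)² ≤ 3 (1 + (x - y)²)`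
    -- when `|x - x₀| < 1`.
    rw [← div_eq_mul_inv, le_div_iff₀ (by positivity), inv_mul_le_iff₀ (by positivity)]
    have hx' : |x - x₀| < 1 := by simpa [Real.dist_eq] using hx
    have h1 : (x - x₀) ^ 2 ≤ 1 := by
      rw [← sq_abs]; nlinarith [abs_nonneg (x - x₀)]
    nlinarith [sq_nonneg ((x - y) + (x - x₀))]
  · exact ((integrable_inv_one_add_sq.comp_sub_left x₀).const_mul _).mul_const _
  · exact ((hD (x - y)).comp_sub_const x y).mul_const (f y)

lemma exists_ckBound_kernelConv_schwartz (n : ℕ) (G : 𝓢(ℝ, ℂ)) :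
    ∃ C, ∀ M f, CkBound 0 M f → CkBound n (C * M) (kernelConv volume G f) := by
  induction n generalizing G with
  | zero => exact ⟨_, fun M f hf => hf.kernelConv G.integrable⟩
  | succ n ih =>
    obtain ⟨C, hC⟩ := ih (SchwartzMap.derivCLM ℂ ℂ G)
    refine ⟨max C (∫ y, ‖G y‖), fun M f hf => ?_⟩
    have hM := hf.nonneg
    exact CkBound.of_hasDerivAt (hasDerivAt_kernelConv_schwartz G hf)
      (fun x => (norm_kernelConv_le G.integrable hf x).trans
        (mul_le_mul_of_nonneg_right (le_max_right _ _) hM))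
      ((hC M f hf).mono (mul_le_mul_of_nonneg_right (le_max_left _ _) hM))

/-! ### Band-limited functions -/

/-- The bounded continuous function `f` has its spectrum in `S`, in the strong sense that it is
annihilated by all integrable functions whose Fourier transform vanishes on `S`. -/
structure BandLimited (S : Set ℝ) (f : ℝ → ℂ) : Prop where
  bounded : ∃ M, CkBound 0 M f
  integral_eq_zero : ∀ g : ℝ → ℂ, Integrable g →
    (∀ l ∈ S, ∫ x, g x * Complex.exp (Complex.I * (l : ℝ) * x) = 0) → ∫ x, f x * g x = 0

lemma norm_exp_I_mul (l x : ℝ) : ‖Complex.exp (Complex.I * l * x)‖ = 1 := by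
  rw [show Complex.I * l * x = ((l * x : ℝ) : ℂ) * Complex.I by push_cast; ring]
  exact Complex.norm_exp_ofReal_mul_I _

lemma integrable_mul_exp {g : ℝ → ℂ} (hg : Integrable g) (l : ℝ) :
    Integrable (fun x : ℝ => g x * Complex.exp (Complex.I * l * x)) :=
  hg.mul_bdd (c := 1) (by fun_prop) (Eventually.of_forall fun x => (norm_exp_I_mul l x).le)

lemma CkBound.integrable_mul {M : ℝ} {f g : ℝ → ℂ} (hf : CkBound 0 M f) (hg : Integrable g) :
    Integrable (fun x => f x * g x) :=
  hg.bdd_mul hf.continuous.aestronglyMeasurable (Eventually.of_forall hf.norm_le)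

namespace BandLimited

variable {S T U : Set ℝ} {f g : ℝ → ℂ}

lemma mono (hf : BandLimited S f) (h : S ⊆ T) : BandLimited T f :=
  ⟨hf.bounded, fun g hg hT => hf.integral_eq_zero g hg fun l hl => hT l (h hl)⟩

lemma add (hf : BandLimited S f) (hg : BandLimited S g) : BandLimited S (f + g) := by
  obtain ⟨M, hM⟩ := hf.bounded
  obtain ⟨M', hM'⟩ := hg.bounded
  refine ⟨⟨_, hM.add hM'⟩, fun k hk h => ?_⟩
  simp only [Pi.add_apply, add_mul]
  rw [integral_add (hM.integrable_mul hk) (hM'.integrable_mul hk), hf.integral_eq_zero k hk h,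
    hg.integral_eq_zero k hk h, add_zero]

lemma const_mul (c : ℂ) (hf : BandLimited S f) : BandLimited S (fun x => c * f x) := by
  obtain ⟨M, hM⟩ := hf.bounded
  refine ⟨⟨_, hM.const_mul c⟩, fun k hk h => ?_⟩
  simp only [mul_assoc]
  rw [integral_const_mul, hf.integral_eq_zero k hk h, mul_zero]

lemma wave (m : ℤ) : BandLimited {(m : ℝ)} (wave m) := by
  refine ⟨exists_ckBound_wave 0 m, fun g hg h => ?_⟩
  rw [← h m rfl]
  congr 1
  ext x
  rw [NonlocalSwiftHohenberg.wave, mul_comm]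
  push_cast
  rfl

/-- Test functions are stable under multiplication by bounded continuous functions and by
characters. To test `f g` against `k`, test `f` against `g k`; the transform of `g k` at `a` is `g`
tested against `k e^{iax}`, whose transform at `b` is that of `k` at `a + b`. -/
lemma mul (hf : BandLimited S f) (hg : BandLimited T g) (hU : ∀ a ∈ S, ∀ b ∈ T, a + b ∈ U) :
    BandLimited U (f * g) := by
  obtain ⟨M, hM⟩ := hf.bounded
  obtain ⟨M', hM'⟩ := hg.bounded
  refine ⟨⟨_, hM.mul hM'⟩, fun k hk h => ?_⟩
  simp only [Pi.mul_apply, mul_assoc]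
  refine hf.integral_eq_zero (fun x => g x * k x) (hM'.integrable_mul hk) fun a ha => ?_
  simp only [mul_assoc]
  refine hg.integral_eq_zero _ ?_ fun b hb => ?_
  · simpa only [mul_assoc] using integrable_mul_exp hk a
  · rw [← h (a + b) (hU a ha b hb)]
    congr 1
    ext x
    rw [mul_assoc, ← Complex.exp_add]
    congr 2
    push_cast
    ring

/-- By Fubini the convolution is an average of translates of `f`. Moving the translation onto the
test function multiplies its Fourier transform by a phase, which preserves its zeros. -/
lemma kernelConv {μ : Measure ℝ} [SFinite μ] {k : ℝ → ℂ} (hk : Integrable k μ)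
    (hf : BandLimited S f) : BandLimited S (kernelConv μ k f) := by
  obtain ⟨M, hM⟩ := hf.bounded
  refine ⟨⟨_, hM.kernelConv hk⟩, fun g hg h => ?_⟩
  have h1 : Integrable (fun p : ℝ × ℝ => k p.2 * f (p.1 - p.2) * g p.1) (volume.prod μ) := by
    have h2 := (hg.mul_prod hk).bdd_mul (c := M) (f := fun p : ℝ × ℝ => f (p.1 - p.2))
      (hM.continuous.comp (continuous_fst.sub continuous_snd)).aestronglyMeasurable
      (Eventually.of_forall fun p => hM.norm_le _)
    refine h2.congr (Eventually.of_forall fun p => ?_)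
    simp only
    ring
  have h3 : ∫ x, NonlocalSwiftHohenberg.kernelConv μ k f x * g x =
      ∫ x, ∫ y, k y * f (x - y) * g x ∂μ := by
    congr 1
    ext x
    rw [NonlocalSwiftHohenberg.kernelConv, integral_mul_const]
  rw [h3, integral_integral_swap h1]
  refine integral_eq_zero_of_ae (Eventually.of_forall fun y => ?_)
  simp only [Pi.zero_apply]
  have h4 : ∫ x, k y * f (x - y) * g x = k y * ∫ x, f x * g (x + y) := by
    rw [← integral_const_mul,
      ← integral_add_right_eq_self (fun x => k y * f (x - y) * g x) y]
    congr 1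
    ext x
    rw [add_sub_cancel_right, mul_assoc]
  rw [h4, hf.integral_eq_zero (fun x => g (x + y)) (hg.comp_add_right y), mul_zero]
  intro l hl
  have h5 := h l hl
  rw [← integral_add_right_eq_self _ y] at h5
  have h6 : ∀ x : ℝ, g (x + y) * Complex.exp (Complex.I * l * x) =
      Complex.exp (-(Complex.I * l * y)) *
        (g (x + y) * Complex.exp (Complex.I * l * ((x + y : ℝ) : ℂ))) := fun x => by
    rw [mul_left_comm, ← Complex.exp_add]
    congr 2
    push_cast
    ring
  simp only [h6]
  rw [integral_const_mul, h5, mul_zero]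

end BandLimited

/-! ### Mode filters and spectra. -/

lemma modeFilter_eq_kernelConv (χ : ℝ → ℝ) (f : ℝ → ℂ) :
    modeFilter χ f = kernelConv volume (modeKernel χ) f := by
  ext x
  simp [modeFilter, convolution, kernelConv]

/-- The output of a mode filter has its spectrum where the cut-off does not vanish. -/
lemma IsModeCutoff.bandLimited {c : Set ℝ} {χ : ℝ → ℝ} (hχ : IsModeCutoff c χ) {f : ℝ → ℂ}
    {M : ℝ} (hf : CkBound 0 M f) {S : Set ℝ} (hS : ∀ l ∉ S, χ l = 0) :
    BandLimited S (modeFilter χ f) := by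
  obtain ⟨G, hG, -⟩ := hχ.exists_schwartz
  refine ⟨⟨_, by rw [modeFilter_eq_kernelConv, hG]; exact hf.kernelConv G.integrable⟩,
    fun g hg h => ?_⟩
  have hχi : Integrable (fun k => (χ k : ℂ)) :=
    (hχ.smooth.continuous.integrable_of_hasCompactSupport hχ.compact).ofReal
  have h1 : Integrable (fun p : ℝ × ℝ => G (p.1 - p.2) * f p.2 * g p.1)
      (volume.prod volume) := by
    have h2 : Integrable (fun p : ℝ × ℝ => g p.1 * G (p.1 - p.2)) (volume.prod volume) := by
      refine (integrable_prod_iff ?_).2 ⟨Eventually.of_forall fun x =>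
        (G.integrable.comp_sub_left x).const_mul (g x), ?_⟩
      · exact hg.aestronglyMeasurable.comp_fst.mul
          (G.continuous.comp (continuous_fst.sub continuous_snd)).aestronglyMeasurable
      · simp only [norm_mul, integral_const_mul]
        have h3 : ∀ x : ℝ, ∫ y, ‖G (x - y)‖ = ∫ y, ‖G y‖ := fun x =>
          integral_sub_left_eq_self (fun y => ‖G y‖) volume x
        simp only [h3]
        exact hg.norm.mul_const _
    refine (h2.bdd_mul (c := M) (f := fun p : ℝ × ℝ => f p.2)
      (hf.continuous.comp continuous_snd).aestronglyMeasurable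
      (Eventually.of_forall fun p => hf.norm_le _)).congr (Eventually.of_forall fun p => ?_)
    simp only
    ring
  have h3 : ∫ x, modeFilter χ f x * g x = ∫ x, ∫ y, G (x - y) * f y * g x := by
    congr 1
    ext x
    rw [modeFilter_eq_kernelConv, hG, kernelConv_volume, integral_mul_const]
  rw [h3, integral_integral_swap h1]
  refine integral_eq_zero_of_ae (Eventually.of_forall fun y => ?_)
  simp only [Pi.zero_apply]
  -- Writing `G` as an inverse Fourier integral and swapping integrals turns the pairing at `y` into
  -- an integral over `k` of `χ k` times the transform of `g` at `k`; off `S` the first factor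
  -- vanishes, on `S` the second.
  have h4 : ∀ x, G (x - y) * f y * g x = ((1 / (2 * Real.pi)) * f y) *
      ∫ k : ℝ, g x * Complex.exp (Complex.I * k * ((x - y : ℝ) : ℂ)) * (χ k : ℂ) := fun x => by
    rw [← congrFun hG (x - y), modeKernel]
    simp only [mul_assoc (g x)]
    rw [integral_const_mul]
    ring
  simp only [h4]
  rw [integral_const_mul, integral_integral_swap]
  · refine mul_eq_zero_of_right _ (integral_eq_zero_of_ae (Eventually.of_forall fun k => ?_))
    simp only [Pi.zero_apply]
    by_cases hk : k ∈ S
    · rw [integral_mul_const]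
      refine mul_eq_zero_of_left ?_ _
      have h6 : ∀ x : ℝ, g x * Complex.exp (Complex.I * k * ((x - y : ℝ) : ℂ)) =
          Complex.exp (-(Complex.I * k * y)) * (g x * Complex.exp (Complex.I * k * x)) := by
        intro x
        rw [mul_left_comm, ← Complex.exp_add]
        congr 2
        push_cast
        ring
      simp only [h6]
      rw [integral_const_mul, h k hk, mul_zero]
    · simp [hS k hk]
  · refine ((hg.mul_prod hχi).bdd_mul (c := 1)
      (f := fun p : ℝ × ℝ => Complex.exp (Complex.I * p.2 * ((p.1 - y : ℝ) : ℂ)))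
      (by fun_prop) (Eventually.of_forall fun p => (norm_exp_I_mul _ _).le)).congr
      (Eventually.of_forall fun p => ?_)
    simp only [Function.uncurry]
    ring

/-- A mode filter annihilates the functions with spectrum in the zero set of the cut-off. -/
lemma IsModeCutoff.modeFilter_eq_zero {c : Set ℝ} {χ : ℝ → ℝ} (hχ : IsModeCutoff c χ)
    {S : Set ℝ} {f : ℝ → ℂ} (hf : BandLimited S f) (hS : ∀ l ∈ S, χ l = 0) :
    modeFilter χ f = 0 := by
  obtain ⟨G, hG, hGχ⟩ := hχ.exists_schwartz
  ext x
  rw [modeFilter_eq_kernelConv, hG, kernelConv_volume]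
  simp only [mul_comm (G _)]
  -- The reflected kernel is an admissible test function: its transform at `l` is `e^{ilx} χ l`,
  -- which is zero on `S`.
  refine hf.integral_eq_zero (fun y => G (x - y)) (G.integrable.comp_sub_left x) fun l hl => ?_
  rw [← integral_sub_left_eq_self _ volume x]
  have h6 : ∀ y : ℝ, G (x - (x - y)) * Complex.exp (Complex.I * l * ((x - y : ℝ) : ℂ)) =
      Complex.exp (Complex.I * l * x) * (G y * Complex.exp (-(Complex.I * l * y))) := fun y => by
    rw [sub_sub_cancel, mul_left_comm, ← Complex.exp_add]
    congr 2
    push_cast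
    ring
  simp only [h6]
  rw [integral_const_mul, hGχ, hS l hl, Complex.ofReal_zero, mul_zero]

/-! ### Families of functions depending on a small parameter -/

section families

variable {ι : Type*}

/-- The family of functions `F` is of size `O(ε^p)` in `C^n_b`. -/
def BigO (ε : ι → ℝ) (n p : ℕ) (F : ι → ℝ → ℂ) : Prop :=
  ∃ C, 0 ≤ C ∧ ∀ i, CkBound n (C * ε i ^ p) (F i)

/-- The constant family. -/
def constFamily (c : ℂ) : ι → ℝ → ℂ := fun _ _ => c

/-- The small parameter as a family of constant functions. -/
def paramFamily (ε : ι → ℝ) : ι → ℝ → ℂ := fun i _ => ε i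

/-- The plane wave as a constant family. -/
def waveFamily (m : ℤ) : ι → ℝ → ℂ := fun _ => wave m

/-- The convolution of a family with a fixed complex measure. -/
def convFamily (μ : Measure ℝ) (k : ℝ → ℂ) (F : ι → ℝ → ℂ) : ι → ℝ → ℂ :=
  fun i => kernelConv μ k (F i)

lemma waveFamily_add (m n : ℤ) :
    (waveFamily (m + n) : ι → ℝ → ℂ) = waveFamily m * waveFamily n :=
  funext fun _ => wave_add m n

namespace BigO

variable {ε : ι → ℝ} {ε₀ : ℝ} {n p p' : ℕ} {F G : ι → ℝ → ℂ}

lemma of_le {m : ℕ} (hF : BigO ε n p F) (hm : m ≤ n) : BigO ε m p F := by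
  obtain ⟨C, hC, h⟩ := hF
  exact ⟨C, hC, fun i => (h i).of_le hm⟩

lemma of_pow_le (hε : ∀ i, 0 < ε i) (hε₀ : ∀ i, ε i ≤ ε₀) (hF : BigO ε n p F) (hp : p' ≤ p) :
    BigO ε n p' F := by
  obtain ⟨C, hC, h⟩ := hF
  refine ⟨C * |ε₀| ^ (p - p'), by positivity, fun i => (h i).mono ?_⟩
  rw [mul_assoc]
  refine mul_le_mul_of_nonneg_left ?_ hC
  rw [← Nat.sub_add_cancel hp, pow_add, Nat.sub_add_cancel hp]
  exact mul_le_mul_of_nonneg_right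
    (pow_le_pow_left₀ (hε i).le ((hε₀ i).trans (le_abs_self _)) _) (pow_nonneg (hε i).le _)

lemma add (hF : BigO ε n p F) (hG : BigO ε n p G) : BigO ε n p (F + G) := by
  obtain ⟨C, hC, h⟩ := hF
  obtain ⟨D, hD, h'⟩ := hG
  exact ⟨C + D, add_nonneg hC hD, fun i => by rw [add_mul]; exact (h i).add (h' i)⟩

lemma mul (hF : BigO ε n p F) (hG : BigO ε n p' G) : BigO ε n (p + p') (F * G) := by
  obtain ⟨C, hC, h⟩ := hF
  obtain ⟨D, hD, h'⟩ := hG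
  exact ⟨2 ^ n * (C * D), by positivity, fun i => ((h i).mul (h' i)).mono (le_of_eq (by ring))⟩

lemma const (c : ℂ) : BigO ε n 0 (constFamily c) :=
  ⟨‖c‖, norm_nonneg _, fun i => by rw [pow_zero, mul_one]; exact CkBound.const c⟩

lemma param (hε : ∀ i, 0 < ε i) : BigO ε n 1 (paramFamily ε) :=
  ⟨1, zero_le_one, fun i => by
    rw [pow_one, one_mul]
    exact (CkBound.const (n := n) (ε i : ℂ)).mono (by simp [abs_of_pos (hε i)])⟩

lemma wave (m : ℤ) : BigO ε n 0 (waveFamily m) := by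
  obtain ⟨M, hM⟩ := exists_ckBound_wave n m
  exact ⟨M, hM.nonneg, fun i => by rw [pow_zero, mul_one]; exact hM⟩

lemma const_mul (c : ℂ) (hF : BigO ε n p F) : BigO ε n p (constFamily c * F) := by
  simpa using (const c).mul hF

lemma neg (hF : BigO ε n p F) : BigO ε n p (-F) := by
  convert hF.const_mul (-1) using 1
  ext i x
  simp [constFamily]

lemma sub (hF : BigO ε n p F) (hG : BigO ε n p G) : BigO ε n p (F - G) := by
  rw [sub_eq_add_neg]
  exact hF.add hG.neg

lemma conv {μ : Measure ℝ} {k : ℝ → ℂ} (hk : Integrable k μ) (hF : BigO ε n p F) :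
    BigO ε n p (convFamily μ k F) := by
  obtain ⟨C, hC, h⟩ := hF
  exact ⟨(∫ y, ‖k y‖ ∂μ) * C, mul_nonneg (integral_nonneg fun y => norm_nonneg _) hC,
    fun i => by rw [mul_assoc]; exact (h i).kernelConv hk⟩

lemma iteratedDeriv {m k : ℕ} (hF : BigO ε n p F) (h : k + m ≤ n) :
    BigO ε m p (fun i => iteratedDeriv k (F i)) := by
  obtain ⟨C, hC, hF⟩ := hF
  exact ⟨C, hC, fun i => (hF i).iteratedDeriv h⟩

lemma deriv (hF : BigO ε (n + 1) p F) : BigO ε n p (fun i => deriv (F i)) := by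
  obtain ⟨C, hC, hF⟩ := hF
  exact ⟨C, hC, fun i => (hF i).2.2⟩

end BigO

/-- A family of bounded functions whose derivatives are of size `O(ε)`. -/
structure Slow (ε : ι → ℝ) (u : ι → ℝ → ℂ) : Prop where
  bounded : BigO ε 1 0 u
  deriv : BigO ε 0 1 (fun i => deriv (u i))

namespace Slow

variable {ε : ι → ℝ} {u v : ι → ℝ → ℂ}

lemma const (c : ℂ) : Slow ε (constFamily c) := by
  refine ⟨BigO.const c, ⟨0, le_rfl, fun i => ?_⟩⟩
  have : _root_.deriv (constFamily c i) = fun _ => (0 : ℂ) := funext fun x => deriv_const x c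
  change CkBound 0 _ (_root_.deriv (constFamily c i))
  rw [zero_mul, ← norm_zero (E := ℂ), this]
  exact CkBound.const (n := 0) (0 : ℂ)

lemma add (hu : Slow ε u) (hv : Slow ε v) : Slow ε (u + v) := by
  refine ⟨hu.1.add hv.1, ?_⟩
  convert hu.2.add hv.2 using 1
  obtain ⟨C, -, h⟩ := hu.1
  obtain ⟨D, -, h'⟩ := hv.1
  ext i x
  exact (((h i).hasDerivAt x).add ((h' i).hasDerivAt x)).deriv

lemma mul (hu : Slow ε u) (hv : Slow ε v) : Slow ε (u * v) := by
  refine ⟨hu.1.mul hv.1, ?_⟩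
  convert (hu.2.mul (hv.1.of_le zero_le_one)).add ((hu.1.of_le zero_le_one).mul hv.2) using 1
  obtain ⟨C, -, h⟩ := hu.1
  obtain ⟨D, -, h'⟩ := hv.1
  ext i x
  exact (((h i).hasDerivAt x).mul ((h' i).hasDerivAt x)).deriv

end Slow

/-- The family `F` is the plane wave `e^{imx}` with the slowly varying amplitude `u`, up to an error
of size `O(ε)` in `C^1_b`. -/
structure Modulates (ε : ι → ℝ) (m : ℤ) (F u : ι → ℝ → ℂ) : Prop where
  slow : Slow ε u
  approx : BigO ε 1 1 (F - u * waveFamily m)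

namespace Modulates

variable {ε : ι → ℝ} {ε₀ : ℝ} {m m' l : ℤ} {F G u v : ι → ℝ → ℂ}

lemma bounded (hε : ∀ i, 0 < ε i) (hε₀ : ∀ i, ε i ≤ ε₀) (hF : Modulates ε m F u) :
    BigO ε 1 0 F := by
  have := (hF.2.of_pow_le hε hε₀ zero_le_one).add (hF.1.1.mul (BigO.wave m))
  rwa [sub_add_cancel] at this

lemma add (hF : Modulates ε m F u) (hG : Modulates ε m G v) :
    Modulates ε m (F + G) (u + v) :=
  ⟨hF.1.add hG.1, by convert hF.2.add hG.2 using 1; ring⟩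

/-- With `w_m` the plane wave, the error is `F (G - v w_m') + (F - u w_m) v w_m'`: each summand is
an `O(ε)` error times a bounded factor. -/
lemma mul (hε : ∀ i, 0 < ε i) (hε₀ : ∀ i, ε i ≤ ε₀) (hF : Modulates ε m F u)
    (hG : Modulates ε m' G v) (hl : m + m' = l) : Modulates ε l (F * G) (u * v) := by
  subst hl
  refine ⟨hF.1.mul hG.1, ?_⟩
  convert ((hF.bounded hε hε₀).mul hG.2).add (hF.2.mul (hG.1.1.mul (BigO.wave m'))) using 1
  rw [waveFamily_add]
  ring

lemma const_mul (c : ℂ) (hF : Modulates ε m F u) :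
    Modulates ε m (constFamily c * F) (constFamily c * u) :=
  ⟨(Slow.const c).mul hF.1, by convert hF.2.const_mul c using 1; ring⟩

lemma neg (hF : Modulates ε m F u) : Modulates ε m (-F) (-u) := by
  convert hF.const_mul (-1) using 1 <;> ext i x <;> simp [constFamily]

lemma sub (hF : Modulates ε m F u) (hG : Modulates ε m G v) : Modulates ε m (F - G) (u - v) := by
  simpa [sub_eq_add_neg] using hF.add hG.neg

/-- The convolution is bounded on `C¹`, so it keeps the error of `F` at `O(ε)`; on the exact
modulated wave, `ckBound_kernelConv_mul_wave_sub` applies. -/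
lemma conv {μ : Measure ℝ} {k : ℝ → ℂ} (hk : Integrable k μ)
    (hk1 : Integrable (fun y => ‖y‖ * ‖k y‖) μ) (hε : ∀ i, 0 < ε i) (hε₀ : ∀ i, ε i ≤ ε₀)
    (hF : Modulates ε m F u) :
    Modulates ε m (convFamily μ k F) (constFamily (kernelCoeff μ k m) * u) := by
  refine ⟨(Slow.const _).mul hF.1, ?_⟩
  obtain ⟨C, hC⟩ := ckBound_kernelConv_mul_wave_sub hk hk1 m
  obtain ⟨D, hD0, hD⟩ := hF.1.2
  obtain ⟨D', hD0', hD'⟩ := hF.1.1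
  obtain ⟨W, hW⟩ := exists_ckBound_wave 1 m
  have h1 : BigO ε 1 1 (convFamily μ k (u * waveFamily m) -
      constFamily (kernelCoeff μ k m) * u * waveFamily m) := by
    refine ⟨|C| * D, by positivity, fun i => ?_⟩
    have h := hC _ _ (u i) (hD' i) (hD i)
    convert h.mono (M' := |C| * D * ε i ^ 1) ?_ using 1
    · ext x
      simp only [Pi.sub_apply, Pi.mul_apply, constFamily, waveFamily, mul_assoc]
      rfl
    · rw [mul_assoc]
      exact mul_le_mul_of_nonneg_right (le_abs_self C) (hD i).nonneg
  have h2 : convFamily μ k (F - u * waveFamily m) =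
      convFamily μ k F - convFamily μ k (u * waveFamily m) := by
    obtain ⟨B, -, hB⟩ := hF.bounded hε hε₀
    obtain ⟨B', -, hB'⟩ := hF.2.of_pow_le hε hε₀ zero_le_one
    rw [eq_sub_iff_add_eq]
    funext i
    have := kernelConv_add hk ((hB' i).of_le zero_le_one)
      (((hD' i).mul hW).of_le zero_le_one)
    refine this.symm.trans ?_
    change kernelConv μ k _ = kernelConv μ k _
    congr 1
    ext x
    simp [waveFamily]
  convert (hF.2.conv hk).add h1 using 1
  rw [h2]
  ring

/-- This converts an algebraic identity between amplitudes into a gain of one power of `ε`; all the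
cancellations in the residual are obtained through it. -/
lemma bigO (hF : Modulates ε m F u) (hu : u = 0) : BigO ε 1 1 F := by
  simpa [hu] using hF.2

end Modulates

/-- The members of the family have their spectra at distance less than `j / 4` from `m`. -/
def BandLimitedFamily (m : ℤ) (j : ℕ) (F : ι → ℝ → ℂ) : Prop :=
  ∀ i, BandLimited (Metric.ball (m : ℝ) (j / 4)) (F i)

namespace BandLimitedFamily

variable {m m' l : ℤ} {j j' : ℕ} {F G : ι → ℝ → ℂ}

lemma of_le (hF : BandLimitedFamily m j F) (h : j ≤ j') : BandLimitedFamily m j' F := fun i =>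
  (hF i).mono (Metric.ball_subset_ball (by gcongr))

lemma add (hF : BandLimitedFamily m j F) (hG : BandLimitedFamily m j G) :
    BandLimitedFamily m j (F + G) := fun i => (hF i).add (hG i)

lemma const_mul (c : ℂ) (hF : BandLimitedFamily m j F) :
    BandLimitedFamily m j (constFamily c * F) := fun i => (hF i).const_mul c

lemma param_mul (ε : ι → ℝ) (hF : BandLimitedFamily m j F) :
    BandLimitedFamily m j (paramFamily ε * F) := fun i => (hF i).const_mul (ε i)

lemma neg (hF : BandLimitedFamily m j F) : BandLimitedFamily m j (-F) := by
  convert hF.const_mul (-1) using 1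
  ext i x
  simp [constFamily]

lemma sub (hF : BandLimitedFamily m j F) (hG : BandLimitedFamily m j G) :
    BandLimitedFamily m j (F - G) := by
  rw [sub_eq_add_neg]
  exact hF.add hG.neg

lemma mul (hF : BandLimitedFamily m j F) (hG : BandLimitedFamily m' j' G) (hl : m + m' = l) :
    BandLimitedFamily l (j + j') (F * G) := fun i =>
  (hF i).mul (hG i) fun a ha b hb => by
    subst hl
    rw [Metric.mem_ball, Real.dist_eq] at *
    push_cast
    calc |a + b - (m + m')| = |(a - m) + (b - m')| := by ring_nf
      _ ≤ |a - m| + |b - m'| := abs_add_le _ _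
      _ < (j + j') / 4 := by linarith

lemma mul_wave (hF : BandLimitedFamily 0 j F) (m : ℤ) :
    BandLimitedFamily m j (F * waveFamily m) := fun i =>
  (hF i).mul (BandLimited.wave m) fun a ha b hb => by
    rw [mem_singleton_iff.1 hb]
    simpa using ha

lemma conv {μ : Measure ℝ} [SFinite μ] {k : ℝ → ℂ} (hk : Integrable k μ)
    (hF : BandLimitedFamily m j F) : BandLimitedFamily m j (convFamily μ k F) := fun i =>
  (hF i).kernelConv hk

/-- The filter around the wave numbers `±1` annihilates the other harmonics. -/
lemma modeFilter_eq_zero {χ : ℝ → ℝ} (hχ : IsModeCutoff {-1, 1} χ)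
    (hF : BandLimitedFamily m j F) (hj : j ≤ 3) (h1 : m ≠ 1) (h2 : m ≠ -1) (i : ι) :
    modeFilter χ (F i) = 0 := by
  -- A common point would put the integer `m` at distance less than `3/4 + 1/4 = 1` from `1` or
  -- `-1`, hence equal to it. The open balls make the borderline total radius `1` admissible.
  refine hχ.modeFilter_eq_zero (hF i) fun l hl => hχ.eq_zero l fun hl' => ?_
  have hj' : (j : ℝ) ≤ 3 := by exact_mod_cast hj
  rw [Metric.mem_ball, Real.dist_eq, abs_lt] at hl
  simp only [mem_insert_iff, mem_singleton_iff, iUnion_iUnion_eq_or_left, iUnion_iUnion_eq_left,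
    mem_union, Metric.mem_ball, Real.dist_eq, abs_lt] at hl'
  rcases hl' with hl' | hl'
  · have h3 : (m : ℝ) < (0 : ℤ) := by push_cast; linarith
    have h4 : ((-2 : ℤ) : ℝ) < m := by push_cast; linarith
    have h5 := Int.cast_lt.1 h3
    have h6 := Int.cast_lt.1 h4
    omega
  · have h3 : (m : ℝ) < (2 : ℤ) := by push_cast; linarith
    have h4 : ((0 : ℤ) : ℝ) < m := by push_cast; linarith
    have h5 := Int.cast_lt.1 h3
    have h6 := Int.cast_lt.1 h4
    omega

end BandLimitedFamily

end families

/-! ### Filtered envelopes -/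

section envelope

variable {ι : Type*} {ε : ι → ℝ} {ε₀ : ℝ} {n p : ℕ} {B : ι → ℝ → ℂ} {χ : ℝ → ℝ}

/-- The family of slowly modulated amplitudes `x ↦ B(ε x)`. -/
def scaleFamily (ε : ι → ℝ) (B : ι → ℝ → ℂ) : ι → ℝ → ℂ := fun i x => B i (ε i * x)

/-- The family of filtered derivatives `E₀ ((∂ᵏ B)(ε ·))` of the amplitudes. -/
def envelope (χ : ℝ → ℝ) (ε : ι → ℝ) (B : ι → ℝ → ℂ) (k : ℕ) : ι → ℝ → ℂ :=
  fun i => filteredAmplitude χ (ε i) (iteratedDeriv k (B i))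

lemma BigO.scale (hε : ∀ i, 0 < ε i) (hε₀ : ∀ i, ε i ≤ ε₀) (hB : BigO ε n p B) :
    BigO ε n p (scaleFamily ε B) := by
  obtain ⟨C, hC, h⟩ := hB
  refine ⟨(max 1 ε₀) ^ n * C, by positivity, fun i => ?_⟩
  rw [mul_assoc]
  exact (h i).comp_mul_left (by rw [abs_of_pos (hε i)]; exact (hε₀ i).trans (le_max_right _ _))
    (le_max_left _ _)

lemma hasDerivAt_scaleFamily (hB : BigO ε 1 p B) (i : ι) (x : ℝ) :
    HasDerivAt (scaleFamily ε B i) ((ε i : ℂ) * scaleFamily ε (fun i => deriv (B i)) i x) x := by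
  obtain ⟨C, -, h⟩ := hB
  have h1 := ((h i).hasDerivAt (ε i * x)).scomp x ((hasDerivAt_id x).const_mul (ε i))
  change HasDerivAt (fun x => B i (ε i * x)) ((ε i : ℂ) * deriv (B i) (ε i * x)) x
  simpa [Function.comp_def] using h1

lemma deriv_scaleFamily (hB : BigO ε 1 p B) :
    (fun i => deriv (scaleFamily ε B i)) =
      paramFamily ε * scaleFamily ε (fun i => deriv (B i)) :=
  funext fun i => funext fun x => (hasDerivAt_scaleFamily hB i x).deriv

lemma BigO.slow_scale (hε : ∀ i, 0 < ε i) (hε₀ : ∀ i, ε i ≤ ε₀) (hB : BigO ε 1 0 B) :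
    Slow ε (scaleFamily ε B) := by
  refine ⟨hB.scale hε hε₀, ?_⟩
  rw [deriv_scaleFamily hB]
  exact (BigO.param hε).mul (hB.deriv.scale hε hε₀)

lemma envelope_apply (k : ℕ) (i : ι) :
    envelope χ ε B k i = modeFilter χ (scaleFamily ε (fun i => iteratedDeriv k (B i)) i) := rfl

/-- The order `n` is unrelated to `N`: smoothing by the Schwartz kernel needs only the supremum of
the `k`-th derivative of `B`. -/
lemma BigO.envelope (hχ : IsModeCutoff {0} χ) (hε : ∀ i, 0 < ε i) (hε₀ : ∀ i, ε i ≤ ε₀)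
    {k N : ℕ} (hB : BigO ε N 0 B) (hk : k ≤ N) : BigO ε n 0 (envelope χ ε B k) := by
  obtain ⟨G, hG, -⟩ := hχ.exists_schwartz
  obtain ⟨C, hC⟩ := exists_ckBound_kernelConv_schwartz n G
  obtain ⟨D, hD0, hD⟩ := (hB.iteratedDeriv (k := k) (m := 0) (by omega)).scale hε hε₀
  refine ⟨|C| * D, by positivity, fun i => ?_⟩
  rw [envelope_apply, modeFilter_eq_kernelConv, hG, mul_assoc]
  exact (hC _ _ (hD i)).mono (mul_le_mul_of_nonneg_right (le_abs_self C) (hD i).nonneg)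

/-- Here the derivative is put on the amplitude rather than on the kernel, which is what produces
the factor `ε`. -/
lemma hasDerivAt_envelope (hχ : IsModeCutoff {0} χ) (hε : ∀ i, 0 < ε i) (hε₀ : ∀ i, ε i ≤ ε₀)
    {k N : ℕ} (hB : BigO ε N 0 B) (hk : k + 1 ≤ N) (i : ι) (x : ℝ) :
    HasDerivAt (envelope χ ε B k i) ((ε i : ℂ) * envelope χ ε B (k + 1) i x) x := by
  obtain ⟨G, hG, -⟩ := hχ.exists_schwartz
  have h1 := hB.iteratedDeriv hk
  obtain ⟨D, hD0, hD⟩ := h1.scale hε hε₀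
  rw [envelope_apply, envelope_apply, modeFilter_eq_kernelConv, modeFilter_eq_kernelConv, hG]
  have hG0 : Integrable G := G.integrable
  have h2 := hasDerivAt_kernelConv hG0 (hD i) x
  rw [congrFun (deriv_scaleFamily h1) i] at h2
  refine h2.congr_deriv ?_
  simp only [← iteratedDeriv_succ]
  exact congrFun (kernelConv_const_mul (ε i : ℂ) _) x

/-- The filter kernel has a finite first moment and integral `χ 0 = 1`, so the convolution estimate
at frequency `0` lets the unfiltered amplitude replace the filtered one. -/
lemma modulates_envelope (hχ : IsModeCutoff {0} χ) (hε : ∀ i, 0 < ε i) (hε₀ : ∀ i, ε i ≤ ε₀)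
    {k N : ℕ} (hB : BigO ε N 0 B) (hk : k + 1 ≤ N) (m : ℤ) :
    Modulates ε m (envelope χ ε B k * waveFamily m)
      (scaleFamily ε (fun i => iteratedDeriv k (B i))) := by
  obtain ⟨G, hG, hGχ⟩ := hχ.exists_schwartz
  have hs := (hB.iteratedDeriv hk).slow_scale hε hε₀
  refine ⟨hs, ?_⟩
  rw [← sub_mul]
  refine BigO.mul (p := 1) (p' := 0) ?_ (BigO.wave m)
  have hG0 : Integrable G := G.integrable
  obtain ⟨C, hC⟩ := ckBound_kernelConv_mul_wave_sub hG0
    (by simpa using G.integrable_pow_mul volume 1) 0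
  have hG1 : kernelCoeff volume G 0 = 1 := by
    have h0 : χ 0 = 1 := hχ.eq_one 0 (by simp)
    have := hGχ 0
    rw [h0] at this
    simpa [kernelCoeff] using this
  obtain ⟨D, hD0, hD⟩ := hs.2
  obtain ⟨D', hD0', hD'⟩ := hs.1
  refine ⟨|C| * D, by positivity, fun i => ?_⟩
  convert (hC _ _ _ (hD' i) (hD i)).mono (M' := |C| * D * ε i ^ 1) ?_ using 1
  · ext x
    rw [hG1, wave_zero, mul_one, Pi.sub_apply, Pi.sub_apply, envelope_apply,
      modeFilter_eq_kernelConv, hG, Pi.one_apply, mul_one, one_mul]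
  · rw [mul_assoc]
    exact mul_le_mul_of_nonneg_right (le_abs_self C) (hD i).nonneg

lemma bandLimitedFamily_envelope (hχ : IsModeCutoff {0} χ) (hε : ∀ i, 0 < ε i)
    (hε₀ : ∀ i, ε i ≤ ε₀) {k N : ℕ} (hB : BigO ε N 0 B) (hk : k ≤ N) (m : ℤ) :
    BandLimitedFamily m 1 (envelope χ ε B k * waveFamily m) := by
  refine BandLimitedFamily.mul_wave (fun i => ?_) m
  obtain ⟨D, -, hD⟩ := (hB.iteratedDeriv (k := k) (m := 0) (by omega)).scale hε hε₀
  rw [envelope_apply]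
  exact hχ.bandLimited (hD i) fun l hl => hχ.eq_zero l (by simpa using hl)

end envelope

/-! ### Time derivatives of filtered functions -/

/-- The time derivative exists only pointwise in `x`. Convexity of `I` and the bound on `v'` control
all difference quotients by `M'`, so dominated convergence carries the limit through the integral.
-/
lemma hasDerivWithinAt_modeFilter {c : Set ℝ} {χ : ℝ → ℝ} (hχ : IsModeCutoff c χ) {I : Set ℝ}
    (hI : Convex ℝ I) {v v' : ℝ → ℝ → ℂ} {M M' : ℝ} (hv : ∀ s ∈ I, CkBound 0 M (v s))
    (hv' : ∀ s ∈ I, CkBound 0 M' (v' s))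
    (h : ∀ s ∈ I, ∀ x, HasDerivWithinAt (fun s => v s x) (v' s x) I s) {t : ℝ} (ht : t ∈ I)
    (x : ℝ) :
    HasDerivWithinAt (fun s => modeFilter χ (v s) x) (modeFilter χ (v' t) x) I t := by
  obtain ⟨G, hG, -⟩ := hχ.exists_schwartz
  simp only [modeFilter_eq_kernelConv, hG]
  rw [hasDerivWithinAt_iff_tendsto_slope]
  have hint : ∀ s ∈ I, Integrable (fun y => G y * v s (x - y)) := fun s hs =>
    integrable_kernelConv G.integrable (hv s hs) x
  have hslope : ∀ s ∈ I, slope (fun s => kernelConv volume G (v s) x) t s =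
      ∫ y, G y * slope (fun s => v s (x - y)) t s := fun s hs => by
    simp only [slope_def_module, kernelConv]
    rw [← integral_sub (hint s hs) (hint t ht), ← integral_smul]
    congr 1
    ext y
    simp only [Complex.real_smul]
    ring
  have hmem : ∀ᶠ s in 𝓝[I \ {t}] t, s ∈ I :=
    eventually_mem_nhdsWithin.mono fun s hs => hs.1
  refine Tendsto.congr' (hmem.mono fun s hs => (hslope s hs).symm) ?_
  refine tendsto_integral_filter_of_dominated_convergence (fun y => ‖G y‖ * M')
    (hmem.mono fun s hs => ?_) (hmem.mono fun s hs => Eventually.of_forall fun y => ?_)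
    (G.integrable.norm.mul_const M') (Eventually.of_forall fun y => ?_)
  · simp only [slope_def_module]
    refine G.continuous.aestronglyMeasurable.mul (Continuous.aestronglyMeasurable ?_)
    exact (((hv s hs).continuous.comp (continuous_const.sub continuous_id)).sub
      ((hv t ht).continuous.comp (continuous_const.sub continuous_id))).const_smul _
  · rw [norm_mul]
    refine mul_le_mul_of_nonneg_left ?_ (norm_nonneg _)
    have h2 : ‖v s (x - y) - v t (x - y)‖ ≤ M' * ‖s - t‖ :=
      hI.norm_image_sub_le_of_norm_hasDerivWithin_le (fun z hz => h z hz (x - y))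
        (fun z hz => (hv' z hz).norm_le _) ht hs
    rw [slope_def_module, norm_smul, norm_inv]
    rcases eq_or_ne s t with rfl | hst
    · simpa using (hv' s hs).nonneg
    · rw [inv_mul_le_iff₀ (norm_pos_iff.2 (sub_ne_zero.2 hst)), mul_comm]
      exact h2
  · exact ((hasDerivWithinAt_iff_tendsto_slope.1 (h t ht (x - y))).const_mul (G y))

lemma mul_mem_Icc_of_mem_Icc_div {a T t : ℝ} (ha : 0 < a) (ht : t ∈ Icc 0 (T / a)) :
    a * t ∈ Icc 0 T :=
  ⟨mul_nonneg ha.le ht.1, by have := (le_div_iff₀ ha).1 ht.2; linarith⟩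

lemma hasDerivWithinAt_filteredAmplitude {c : Set ℝ} {χ : ℝ → ℝ} (hχ : IsModeCutoff c χ)
    {Tstar ε t : ℝ} {B B' : ℝ → ℝ → ℂ} {M M' : ℝ} (hB : ∀ T ∈ Icc 0 Tstar, CkBound 0 M (B T))
    (hB' : ∀ T ∈ Icc 0 Tstar, CkBound 0 M' (B' T))
    (h : ∀ T ∈ Icc 0 Tstar, ∀ X, HasDerivWithinAt (fun S => B S X) (B' T X) (Icc 0 Tstar) T)
    (hε : 0 < ε) (ht : t ∈ Icc 0 (Tstar / ε ^ 2)) (x : ℝ) :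
    HasDerivWithinAt (fun s => filteredAmplitude χ ε (B (ε ^ 2 * s)) x)
      ((ε : ℂ) ^ 2 * filteredAmplitude χ ε (B' (ε ^ 2 * t)) x) (Icc 0 (Tstar / ε ^ 2)) t := by
  have hmap : MapsTo (fun s => ε ^ 2 * s) (Icc 0 (Tstar / ε ^ 2)) (Icc 0 Tstar) := fun s hs =>
    mul_mem_Icc_of_mem_Icc_div (by positivity) hs
  have hscale : ∀ {N : ℝ} {f : ℝ → ℂ}, CkBound 0 N f → CkBound 0 N (fun x => f (ε * x)) :=
    fun hf => ⟨hf.continuous.comp (continuous_const.mul continuous_id), fun x => hf.norm_le _⟩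
  have key := hasDerivWithinAt_modeFilter hχ (convex_Icc 0 (Tstar / ε ^ 2))
    (v := fun s x => B (ε ^ 2 * s) (ε * x))
    (v' := fun s x => (ε : ℂ) ^ 2 * B' (ε ^ 2 * s) (ε * x))
    (fun s hs => hscale (hB _ (hmap hs)))
    (fun s hs => (hscale (hB' _ (hmap hs))).const_mul ((ε : ℂ) ^ 2))
    (fun s hs x => by
      have h1 := (h _ (hmap hs) (ε * x)).scomp s
        ((hasDerivWithinAt_id s (Icc 0 (Tstar / ε ^ 2))).const_mul (ε ^ 2)) hmap
      simpa [Function.comp_def] using h1) ht x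
  refine key.congr_deriv ?_
  rw [filteredAmplitude, modeFilter_eq_kernelConv, modeFilter_eq_kernelConv, kernelConv_const_mul]

/-! ### The linear part -/

/-- `f` is twice differentiable and `g = (1 + ∂²) f`, the derivatives being taken one by one. -/
def HasOnePlusDxx (f g : ℝ → ℂ) : Prop :=
  ∃ f' : ℝ → ℂ, (∀ x, HasDerivAt f (f' x) x) ∧ ∀ x, HasDerivAt f' (g x - f x) x

namespace HasOnePlusDxx

variable {f g f₁ g₁ : ℝ → ℂ}

lemma onePlusDxx_eq (h : HasOnePlusDxx f g) : onePlusDxx f = g := by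
  obtain ⟨f', h1, h2⟩ := h
  ext x
  rw [onePlusDxx, iteratedDeriv_succ, iteratedDeriv_one,
    show deriv f = f' from funext fun x => (h1 x).deriv, (h2 x).deriv]
  ring

lemma add (h : HasOnePlusDxx f g) (h₁ : HasOnePlusDxx f₁ g₁) :
    HasOnePlusDxx (f + f₁) (g + g₁) := by
  obtain ⟨f', h1, h2⟩ := h
  obtain ⟨f₁', h1', h2'⟩ := h₁
  refine ⟨f' + f₁', fun x => (h1 x).add (h1' x), fun x =>
    ((h2 x).add (h2' x)).congr_deriv ?_⟩
  simp only [Pi.add_apply]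
  ring

lemma const_mul (c : ℂ) (h : HasOnePlusDxx f g) :
    HasOnePlusDxx (fun x => c * f x) (fun x => c * g x) := by
  obtain ⟨f', h1, h2⟩ := h
  refine ⟨fun x => c * f' x, fun x => (h1 x).const_mul c, fun x =>
    ((h2 x).const_mul c).congr_deriv ?_⟩
  ring

lemma mul_wave {e : ℂ} {a b c : ℝ → ℂ} (ha : ∀ x, HasDerivAt a (e * b x) x)
    (hb : ∀ x, HasDerivAt b (e * c x) x) (m : ℤ) :
    HasOnePlusDxx (a * wave m)
      ((fun x => e ^ 2 * c x + 2 * Complex.I * m * e * b x + (1 - m ^ 2) * a x) * wave m) := by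
  refine ⟨fun x => (e * b x + Complex.I * m * a x) * wave m x, fun x => ?_, fun x => ?_⟩
  · refine ((ha x).mul (hasDerivAt_wave m x)).congr_deriv ?_
    ring
  · refine ((((hb x).const_mul e).add ((ha x).const_mul (Complex.I * m))).mul
      (hasDerivAt_wave m x)).congr_deriv ?_
    simp only [Pi.mul_apply, Pi.add_apply]
    linear_combination (m : ℂ) ^ 2 * a x * wave m x * Complex.I_sq

end HasOnePlusDxx

/-- `g = (1 + ∂²)² f`, the derivatives being taken one by one. -/
def HasOnePlusDxxSq (f g : ℝ → ℂ) : Prop :=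
  ∃ h, HasOnePlusDxx f h ∧ HasOnePlusDxx h g

namespace HasOnePlusDxxSq

variable {f g f₁ g₁ : ℝ → ℂ}

lemma linearPart_eq (h : HasOnePlusDxxSq f g) (ε x : ℝ) :
    linearPart ε f x = -g x + (ε : ℂ) ^ 2 * f x := by
  obtain ⟨k, h1, h2⟩ := h
  rw [linearPart, h1.onePlusDxx_eq, h2.onePlusDxx_eq]

lemma add (h : HasOnePlusDxxSq f g) (h₁ : HasOnePlusDxxSq f₁ g₁) :
    HasOnePlusDxxSq (f + f₁) (g + g₁) := by
  obtain ⟨k, h1, h2⟩ := h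
  obtain ⟨k', h1', h2'⟩ := h₁
  exact ⟨_, h1.add h1', h2.add h2'⟩

lemma const_mul (c : ℂ) (h : HasOnePlusDxxSq f g) :
    HasOnePlusDxxSq (fun x => c * f x) (fun x => c * g x) := by
  obtain ⟨k, h1, h2⟩ := h
  exact ⟨_, h1.const_mul c, h2.const_mul c⟩

/-- On amplitudes at wave number `m` the operator is `(∂² + 2im∂ + 1 - m²)²`, and each `∂`
contributes a factor `e`. The coefficient `2 - 6m²` is `(2im)² + 2(1 - m²)`. -/
lemma mul_wave {e : ℂ} {a : ℕ → ℝ → ℂ}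
    (ha : ∀ k < 4, ∀ x, HasDerivAt (a k) (e * a (k + 1) x) x) (m : ℤ) :
    HasOnePlusDxxSq (a 0 * wave m)
      ((fun x => e ^ 4 * a 4 x + 4 * Complex.I * m * e ^ 3 * a 3 x + (2 - 6 * m ^ 2) * e ^ 2 * a 2 x
        + 4 * Complex.I * m * (1 - m ^ 2) * e * a 1 x + (1 - m ^ 2) ^ 2 * a 0 x) * wave m) := by
  refine ⟨_, HasOnePlusDxx.mul_wave (ha 0 (by norm_num)) (ha 1 (by norm_num)) m, ?_⟩
  -- Amplitudes after one application of the operator; they form the same kind of derivative chain,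
  -- so the first order rule applies again.
  set b : ℕ → ℝ → ℂ := fun k x =>
    e ^ 2 * a (k + 2) x + 2 * Complex.I * m * e * a (k + 1) x + (1 - m ^ 2) * a k x with hb
  have hb' : ∀ k < 2, ∀ x, HasDerivAt (b k) (e * b (k + 1) x) x := fun k hk x => by
    refine ((((ha (k + 2) (by omega) x).const_mul (e ^ 2)).add
      ((ha (k + 1) (by omega) x).const_mul (2 * Complex.I * m * e))).add
      ((ha k (by omega) x).const_mul (1 - (m : ℂ) ^ 2))).congr_deriv ?_
    simp only [hb]
    ring
  convert HasOnePlusDxx.mul_wave (hb' 0 (by norm_num)) (hb' 1 (by norm_num)) m using 2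
  ext x
  simp only [hb]
  linear_combination -4 * (m : ℂ) ^ 2 * e ^ 2 * a 2 x * Complex.I_sq

end HasOnePlusDxxSq

/-! ### Amplitudes -/

/-- `B` is bounded in `C^4_b` and has the time derivative `B'`, which is bounded in `C^2_b`. -/
structure IsAmplitude (Tstar : ℝ) (B B' : ℝ → ℝ → ℂ) : Prop where
  bounded : ∃ M, ∀ T ∈ Icc 0 Tstar, CkBound 4 M (B T)
  bounded_deriv : ∃ M, ∀ T ∈ Icc 0 Tstar, CkBound 2 M (B' T)
  hasDeriv : ∀ T ∈ Icc 0 Tstar, ∀ X,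
    HasDerivWithinAt (fun S => B S X) (B' T X) (Icc 0 Tstar) T

namespace IsAmplitude

variable {Tstar : ℝ} {B B' D D' : ℝ → ℝ → ℂ}

lemma mul (hB : IsAmplitude Tstar B B') (hD : IsAmplitude Tstar D D') :
    IsAmplitude Tstar (B * D) (B' * D + B * D') := by
  obtain ⟨⟨M₁, h₁⟩, ⟨M₁', h₁'⟩, hd₁⟩ := hB
  obtain ⟨⟨M₂, h₂⟩, ⟨M₂', h₂'⟩, hd₂⟩ := hD
  refine ⟨⟨_, fun T hT => (h₁ T hT).mul (h₂ T hT)⟩, ⟨_, fun T hT =>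
    ((h₁' T hT).mul ((h₂ T hT).of_le (by norm_num))).add
      (((h₁ T hT).of_le (by norm_num)).mul (h₂' T hT))⟩, fun T hT X => ?_⟩
  exact (hd₁ T hT X).mul (hd₂ T hT X)

lemma const_mul (c : ℂ) (hB : IsAmplitude Tstar B B') :
    IsAmplitude Tstar (fun T X => c * B T X) (fun T X => c * B' T X) := by
  obtain ⟨⟨M₁, h₁⟩, ⟨M₁', h₁'⟩, hd₁⟩ := hB
  exact ⟨⟨_, fun T hT => (h₁ T hT).const_mul c⟩, ⟨_, fun T hT => (h₁' T hT).const_mul c⟩,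
    fun T hT X => (hd₁ T hT X).const_mul c⟩

lemma comp_conj (hB : IsAmplitude Tstar B B') :
    IsAmplitude Tstar (fun T X => conj (B T X)) (fun T X => conj (B' T X)) := by
  obtain ⟨⟨M₁, h₁⟩, ⟨M₁', h₁'⟩, hd₁⟩ := hB
  exact ⟨⟨_, fun T hT => (h₁ T hT).comp_conj⟩, ⟨_, fun T hT => (h₁' T hT).comp_conj⟩,
    fun T hT X => Complex.conjCLE.toContinuousLinearMap.hasFDerivAt.comp_hasDerivWithinAt T
      (hd₁ T hT X)⟩

end IsAmplitude

/-- The right-hand side of the Ginzburg-Landau equation. -/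
def ginzburgLandauRHS (c : ℂ) (A : ℝ → ℝ → ℂ) (T X : ℝ) : ℂ :=
  A T X + 4 * iteratedDeriv 2 (A T) X - c * (‖A T X‖ : ℂ) ^ 2 * A T X

/-- The equation trades the time derivative for two space derivatives, which is why the time
derivative is only controlled in `C²`. -/
lemma IsGinzburgLandauSolution.isAmplitude {Q K : SignedMeasure ℝ} {Tstar : ℝ}
    {A : ℝ → ℝ → ℂ} (hA : IsGinzburgLandauSolution Q K Tstar A) :
    IsAmplitude Tstar A (ginzburgLandauRHS (cubicCoefficient Q K) A) := by
  obtain ⟨M, hM⟩ := hA.regular.exists_ckBound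
  refine ⟨⟨M, hM⟩, ⟨M + ‖(4 : ℂ)‖ * M + ‖-cubicCoefficient Q K‖ * (2 ^ 2 * (2 ^ 2 * (M * M) * M)),
    fun T hT => ?_⟩, hA.equation⟩
  have h0 := (hM T hT).of_le (m := 2) (by norm_num)
  have h2 := (hM T hT).iteratedDeriv (k := 2) (m := 2) (by norm_num)
  convert (h0.add (h2.const_mul 4)).add
    (((h0.mul h0.comp_conj).mul h0).const_mul (-cubicCoefficient Q K)) using 1
  ext X
  simp only [ginzburgLandauRHS, Pi.add_apply, Pi.mul_apply, Complex.mul_conj']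
  ring

/-! ### Harmonics -/

section harmonic

variable {ι : Type*} {ε t : ι → ℝ} {ε₀ Tstar : ℝ} {B B' : ℝ → ℝ → ℂ} {χ : ℝ → ℝ}

/-- The family of the values of the amplitude `B` at the slow times `ε² t`. -/
def slowTimeFamily (ε t : ι → ℝ) (B : ℝ → ℝ → ℂ) : ι → ℝ → ℂ := fun i => B (ε i ^ 2 * t i)

/-- The plane wave `e^{imx}` with the filtered amplitude `E₀ (∂_X^k B)`. -/
def harmonic (χ : ℝ → ℝ) (ε t : ι → ℝ) (B : ℝ → ℝ → ℂ) (k : ℕ) (m : ℤ) : ι → ℝ → ℂ :=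
  envelope χ ε (slowTimeFamily ε t B) k * waveFamily m

/-- The unfiltered slowly varying amplitude `∂_X^k B`. -/
def slowAmplitude (ε t : ι → ℝ) (B : ℝ → ℝ → ℂ) (k : ℕ) : ι → ℝ → ℂ :=
  scaleFamily ε (fun i => iteratedDeriv k (slowTimeFamily ε t B i))

lemma bigO_slowTimeFamily {n : ℕ} {M : ℝ} (hε : ∀ i, 0 < ε i)
    (ht : ∀ i, t i ∈ Icc 0 (Tstar / ε i ^ 2)) (hB : ∀ T ∈ Icc 0 Tstar, CkBound n M (B T)) :
    BigO ε n 0 (slowTimeFamily ε t B) := by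
  refine ⟨|M|, abs_nonneg M, fun i => ?_⟩
  rw [pow_zero, mul_one]
  exact (hB _ (mul_mem_Icc_of_mem_Icc_div (pow_pos (hε i) 2) (ht i))).mono (le_abs_self M)

lemma IsAmplitude.bigO (hε : ∀ i, 0 < ε i) (ht : ∀ i, t i ∈ Icc 0 (Tstar / ε i ^ 2))
    (hB : IsAmplitude Tstar B B') : BigO ε 4 0 (slowTimeFamily ε t B) := by
  obtain ⟨M, hM⟩ := hB.bounded
  exact bigO_slowTimeFamily hε ht hM

lemma IsAmplitude.bigO_deriv (hε : ∀ i, 0 < ε i) (ht : ∀ i, t i ∈ Icc 0 (Tstar / ε i ^ 2))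
    (hB : IsAmplitude Tstar B B') : BigO ε 2 0 (slowTimeFamily ε t B') := by
  obtain ⟨M, hM⟩ := hB.bounded_deriv
  exact bigO_slowTimeFamily hε ht hM

lemma BigO.harmonic (hχ : IsModeCutoff {0} χ) (hε : ∀ i, 0 < ε i) (hε₀ : ∀ i, ε i ≤ ε₀)
    {n k N : ℕ} (hB : BigO ε N 0 (slowTimeFamily ε t B)) (hk : k ≤ N) (m : ℤ) :
    BigO ε n 0 (harmonic χ ε t B k m) :=
  (hB.envelope hχ hε hε₀ hk).mul (BigO.wave m)

/-- The family `(1 + ∂²)²` of the harmonic of wave number `m` with amplitude `B`. -/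
def harmonicSq (χ : ℝ → ℝ) (ε t : ι → ℝ) (B : ℝ → ℝ → ℂ) (m : ℤ) : ι → ℝ → ℂ :=
  paramFamily ε ^ 4 * harmonic χ ε t B 4 m
    + constFamily (4 * Complex.I * m) * paramFamily ε ^ 3 * harmonic χ ε t B 3 m
    + constFamily (2 - 6 * (m : ℂ) ^ 2) * paramFamily ε ^ 2 * harmonic χ ε t B 2 m
    + constFamily (4 * Complex.I * m * (1 - (m : ℂ) ^ 2)) * paramFamily ε * harmonic χ ε t B 1 m
    + constFamily ((1 - (m : ℂ) ^ 2) ^ 2) * harmonic χ ε t B 0 m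

lemma hasOnePlusDxxSq_harmonic (hχ : IsModeCutoff {0} χ) (hε : ∀ i, 0 < ε i)
    (hε₀ : ∀ i, ε i ≤ ε₀) (hB : BigO ε 4 0 (slowTimeFamily ε t B)) (m : ℤ) (i : ι) :
    HasOnePlusDxxSq (harmonic χ ε t B 0 m i) (harmonicSq χ ε t B m i) := by
  convert HasOnePlusDxxSq.mul_wave (e := ε i)
    (a := fun k => envelope χ ε (slowTimeFamily ε t B) k i)
    (fun k hk x => hasDerivAt_envelope hχ hε hε₀ hB (by omega) i x) m using 1
  · rfl
  · ext x
    simp only [harmonicSq, harmonic, Pi.add_apply, Pi.mul_apply, Pi.pow_apply, constFamily,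
      paramFamily, waveFamily]
    ring

lemma hasDerivWithinAt_harmonic (hχ : IsModeCutoff {0} χ) (hε : ∀ i, 0 < ε i)
    (ht : ∀ i, t i ∈ Icc 0 (Tstar / ε i ^ 2)) (hB : IsAmplitude Tstar B B') (m : ℤ) (i : ι)
    (x : ℝ) :
    HasDerivWithinAt (fun s => filteredAmplitude χ (ε i) (B (ε i ^ 2 * s)) x * wave m x)
      ((paramFamily ε ^ 2 * harmonic χ ε t B' 0 m) i x) (Icc 0 (Tstar / ε i ^ 2)) (t i) := by
  obtain ⟨M, hM⟩ := hB.bounded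
  obtain ⟨M', hM'⟩ := hB.bounded_deriv
  refine ((hasDerivWithinAt_filteredAmplitude hχ (fun T hT => (hM T hT).of_le (by norm_num))
    (fun T hT => (hM' T hT).of_le (by norm_num)) hB.hasDeriv (hε i) (ht i) x).mul_const
    (wave m x)).congr_deriv ?_
  simp only [harmonic, Pi.mul_apply, Pi.pow_apply, paramFamily, waveFamily, envelope,
    slowTimeFamily, iteratedDeriv_zero]
  ring

end harmonic

/-! ### Linearity of convolution on families. -/

section convFamily

variable {ι : Type*} {ε : ι → ℝ} {F G : ι → ℝ → ℂ} {μ : Measure ℝ} {k : ℝ → ℂ} {p p' : ℕ}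

lemma convFamily_add (hk : Integrable k μ) (hF : BigO ε 0 p F) (hG : BigO ε 0 p' G) :
    convFamily μ k (F + G) = convFamily μ k F + convFamily μ k G := by
  obtain ⟨C, -, hF⟩ := hF
  obtain ⟨D, -, hG⟩ := hG
  exact funext fun i => kernelConv_add hk (hF i) (hG i)

lemma convFamily_param_mul :
    convFamily μ k (paramFamily ε * F) = paramFamily ε * convFamily μ k F :=
  funext fun i => kernelConv_const_mul (ε i : ℂ) (F i)

lemma convFamily_param_pow_mul (n : ℕ) :
    convFamily μ k (paramFamily ε ^ n * F) = paramFamily ε ^ n * convFamily μ k F := by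
  induction n with
  | zero => simp
  | succ n ih => rw [pow_succ', mul_assoc, convFamily_param_mul, ih, mul_assoc]

end convFamily

/-! ### Expansion of the residual -/

section residual

variable {ι : Type*} {ε t : ι → ℝ} {ε₀ Tstar : ℝ} {χ : ℝ → ℝ} {A A' B B' : ℝ → ℝ → ℂ}
  {Q K : SignedMeasure ℝ}

/-- The terms of relative order `ε` in `harmonicSq`. -/
def harmonicSqRem (χ : ℝ → ℝ) (ε t : ι → ℝ) (B : ℝ → ℝ → ℂ) (m : ℤ) : ι → ℝ → ℂ :=
  paramFamily ε ^ 3 * harmonic χ ε t B 4 m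
    + constFamily (4 * Complex.I * m) * (paramFamily ε ^ 2 * harmonic χ ε t B 3 m)
    + constFamily (2 - 6 * (m : ℂ) ^ 2) * (paramFamily ε * harmonic χ ε t B 2 m)
    + constFamily (4 * Complex.I * m * (1 - (m : ℂ) ^ 2)) * harmonic χ ε t B 1 m

lemma harmonicSq_eq (m : ℤ) : harmonicSq χ ε t B m =
    constFamily ((1 - (m : ℂ) ^ 2) ^ 2) * harmonic χ ε t B 0 m
      + paramFamily ε * harmonicSqRem χ ε t B m := by
  rw [harmonicSq, harmonicSqRem]
  ring

/-- The symbol `(1 - m²)²` has a double zero at the critical wave numbers, so the expansion starts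
at `ε²`; the leading coefficient `-4` gives the diffusion term `4 ∂_X²`. -/
lemma harmonicSq_eq_of_sq_eq_one {m : ℤ} (hm : m ^ 2 = 1) : harmonicSq χ ε t B m =
    paramFamily ε ^ 2 * (constFamily (-4) * harmonic χ ε t B 2 m + paramFamily ε *
      (paramFamily ε * harmonic χ ε t B 4 m
        + constFamily (4 * Complex.I * m) * harmonic χ ε t B 3 m)) := by
  have hm' : (m : ℂ) ^ 2 = 1 := by exact_mod_cast hm
  ext i x
  simp only [harmonicSq, Pi.add_apply, Pi.mul_apply, Pi.pow_apply, constFamily, hm']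
  ring

lemma BandLimitedFamily.harmonic (hχ : IsModeCutoff {0} χ) (hε : ∀ i, 0 < ε i)
    (hε₀ : ∀ i, ε i ≤ ε₀) {k N : ℕ} (hB : BigO ε N 0 (slowTimeFamily ε t B)) (hk : k ≤ N) (m : ℤ) :
    BandLimitedFamily m 1 (harmonic χ ε t B k m) :=
  bandLimitedFamily_envelope hχ hε hε₀ hB hk m

lemma bandLimitedFamily_param_pow_mul {m : ℤ} {j : ℕ} {F : ι → ℝ → ℂ}
    (hF : BandLimitedFamily m j F) (n : ℕ) :
    BandLimitedFamily m j (paramFamily ε ^ n * F) := by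
  induction n with
  | zero => simpa using hF
  | succ n ih => rw [pow_succ', mul_assoc]; exact ih.param_mul ε

lemma bandLimitedFamily_harmonicSqRem (hχ : IsModeCutoff {0} χ) (hε : ∀ i, 0 < ε i)
    (hε₀ : ∀ i, ε i ≤ ε₀) (hB : BigO ε 4 0 (slowTimeFamily ε t B)) (m : ℤ) :
    BandLimitedFamily m 1 (harmonicSqRem χ ε t B m) := by
  have h : ∀ k ≤ 4, BandLimitedFamily m 1 (harmonic χ ε t B k m) := fun k hk =>
    BandLimitedFamily.harmonic hχ hε hε₀ hB hk m
  exact (((bandLimitedFamily_param_pow_mul (h 4 le_rfl) 3).add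
    ((bandLimitedFamily_param_pow_mul (h 3 (by norm_num)) 2).const_mul _)).add
    (((h 2 (by norm_num)).param_mul ε).const_mul _)).add ((h 1 (by norm_num)).const_mul _)

lemma BigO.param_pow (hε : ∀ i, 0 < ε i) (n m : ℕ) : BigO ε n m (paramFamily ε ^ m) := by
  induction m with
  | zero => exact BigO.const 1
  | succ m ih => rw [pow_succ]; exact ih.mul (BigO.param hε)

lemma BigO.param_pow_mul (hε : ∀ i, 0 < ε i) (hε₀ : ∀ i, ε i ≤ ε₀) {n p : ℕ} {F : ι → ℝ → ℂ}
    (hF : BigO ε n p F) (m : ℕ) {p' : ℕ} (hp : p' ≤ m + p) :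
    BigO ε n p' (paramFamily ε ^ m * F) :=
  ((BigO.param_pow hε n m).mul hF).of_pow_le hε hε₀ hp

lemma bigO_harmonicSqRem (hχ : IsModeCutoff {0} χ) (hε : ∀ i, 0 < ε i)
    (hε₀ : ∀ i, ε i ≤ ε₀) (hB : BigO ε 4 0 (slowTimeFamily ε t B)) (n : ℕ) (m : ℤ) :
    BigO ε n 0 (harmonicSqRem χ ε t B m) := by
  have h : ∀ k ≤ 4, BigO ε n 0 (harmonic χ ε t B k m) := fun k hk =>
    BigO.harmonic hχ hε hε₀ hB hk m
  refine ((((h 4 le_rfl).param_pow_mul hε hε₀ 3 (by norm_num)).add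
    (((h 3 (by norm_num)).param_pow_mul hε hε₀ 2 (by norm_num)).const_mul _)).add
    (BigO.const_mul _ ?_)).add ((h 1 (by norm_num)).const_mul _)
  simpa using (h 2 (by norm_num)).param_pow_mul hε hε₀ 1 (p' := 0) (by norm_num)

/-- The family of approximations with the given amplitudes of the harmonics. -/
def ansatz (χ : ℝ → ℝ) (ε t : ι → ℝ) (B₁ C₁ B₂ C₂ B₀ : ℝ → ℝ → ℂ) : ι → ℝ → ℂ :=
  paramFamily ε * (harmonic χ ε t B₁ 0 1 + harmonic χ ε t C₁ 0 (-1))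
    + paramFamily ε ^ 2 * (harmonic χ ε t B₂ 0 2 + harmonic χ ε t C₂ 0 (-2)
      + harmonic χ ε t B₀ 0 0)

/-- The pointwise complex conjugate of an amplitude. -/
def conjAmplitude (B : ℝ → ℝ → ℂ) (T X : ℝ) : ℂ := conj (B T X)

/-- The second harmonic amplitude as a function of time. -/
def secondAmplitude (Q : SignedMeasure ℝ) (A : ℝ → ℝ → ℂ) (T : ℝ) : ℝ → ℂ :=
  secondHarmonic Q (A T)

/-- The mean-mode amplitude as a function of time. -/
def meanAmplitude (Q : SignedMeasure ℝ) (A : ℝ → ℝ → ℂ) (T : ℝ) : ℝ → ℂ := meanMode Q (A T)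

lemma refinedApproximation_apply (e s x : ℝ) : refinedApproximation Q χ e A s x =
    e * (filteredAmplitude χ e (A (e ^ 2 * s)) x * wave 1 x
        + filteredAmplitude χ e (conjAmplitude A (e ^ 2 * s)) x * wave (-1) x)
      + (e : ℂ) ^ 2 * (filteredAmplitude χ e (secondAmplitude Q A (e ^ 2 * s)) x * wave 2 x
        + filteredAmplitude χ e (conjAmplitude (secondAmplitude Q A) (e ^ 2 * s)) x * wave (-2) x
        + filteredAmplitude χ e (meanAmplitude Q A (e ^ 2 * s)) x * wave 0 x) := by
  rw [wave_zero, Pi.one_apply, mul_one]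
  rfl

lemma refinedApproximation_eq_ansatz (i : ι) :
    refinedApproximation Q χ (ε i) A (t i) = ansatz χ ε t A (conjAmplitude A)
      (secondAmplitude Q A) (conjAmplitude (secondAmplitude Q A)) (meanAmplitude Q A) i := by
  ext x
  rw [refinedApproximation_apply]
  simp only [ansatz, harmonic, Pi.add_apply, Pi.mul_apply, Pi.pow_apply, paramFamily, waveFamily,
    envelope, slowTimeFamily, iteratedDeriv_zero]

variable {C₁' B₂' C₂' B₀' : ℝ → ℝ → ℂ}

lemma hasDerivWithinAt_refinedApproximation (hχ : IsModeCutoff {0} χ) (hε : ∀ i, 0 < ε i)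
    (ht : ∀ i, t i ∈ Icc 0 (Tstar / ε i ^ 2)) (h₁ : IsAmplitude Tstar A A')
    (h₁c : IsAmplitude Tstar (conjAmplitude A) C₁')
    (h₂ : IsAmplitude Tstar (secondAmplitude Q A) B₂')
    (h₂c : IsAmplitude Tstar (conjAmplitude (secondAmplitude Q A)) C₂')
    (h₀ : IsAmplitude Tstar (meanAmplitude Q A) B₀') (i : ι) (x : ℝ) :
    HasDerivWithinAt (fun s => refinedApproximation Q χ (ε i) A s x)
      ((paramFamily ε ^ 2 * ansatz χ ε t A' C₁' B₂' C₂' B₀') i x)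
      (Icc 0 (Tstar / ε i ^ 2)) (t i) := by
  simp only [refinedApproximation_apply]
  have hd := fun {B B' : ℝ → ℝ → ℂ} (hB : IsAmplitude Tstar B B') (m : ℤ) =>
    hasDerivWithinAt_harmonic hχ hε ht hB m i x
  refine ((((hd h₁ 1).add (hd h₁c (-1))).const_mul (ε i : ℂ)).add
    ((((hd h₂ 2).add (hd h₂c (-2))).add (hd h₀ 0)).const_mul ((ε i : ℂ) ^ 2))).congr_deriv ?_
  simp only [ansatz, Pi.add_apply, Pi.mul_apply, Pi.pow_apply, paramFamily]
  ring

lemma hasOnePlusDxxSq_ansatz (hχ : IsModeCutoff {0} χ) (hε : ∀ i, 0 < ε i)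
    (hε₀ : ∀ i, ε i ≤ ε₀) {B₁ C₁ B₂ C₂ B₀ : ℝ → ℝ → ℂ}
    (h₁ : BigO ε 4 0 (slowTimeFamily ε t B₁)) (h₁c : BigO ε 4 0 (slowTimeFamily ε t C₁))
    (h₂ : BigO ε 4 0 (slowTimeFamily ε t B₂)) (h₂c : BigO ε 4 0 (slowTimeFamily ε t C₂))
    (h₀ : BigO ε 4 0 (slowTimeFamily ε t B₀)) (i : ι) :
    HasOnePlusDxxSq (ansatz χ ε t B₁ C₁ B₂ C₂ B₀ i)
      ((paramFamily ε * (harmonicSq χ ε t B₁ 1 + harmonicSq χ ε t C₁ (-1))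
        + paramFamily ε ^ 2 * (harmonicSq χ ε t B₂ 2 + harmonicSq χ ε t C₂ (-2)
          + harmonicSq χ ε t B₀ 0)) i) := by
  have hd := fun {B : ℝ → ℝ → ℂ} (hB : BigO ε 4 0 (slowTimeFamily ε t B)) (m : ℤ) =>
    hasOnePlusDxxSq_harmonic hχ hε hε₀ hB m i
  exact (((hd h₁ 1).add (hd h₁c (-1))).const_mul (ε i : ℂ)).add
    ((((hd h₂ 2).add (hd h₂c (-2))).add (hd h₀ 0)).const_mul ((ε i : ℂ) ^ 2))

lemma BigO.ansatz (hχ : IsModeCutoff {0} χ) (hε : ∀ i, 0 < ε i)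
    (hε₀ : ∀ i, ε i ≤ ε₀) {B₁ C₁ B₂ C₂ B₀ : ℝ → ℝ → ℂ} (n : ℕ)
    (h₁ : BigO ε 0 0 (slowTimeFamily ε t B₁)) (h₁c : BigO ε 0 0 (slowTimeFamily ε t C₁))
    (h₂ : BigO ε 0 0 (slowTimeFamily ε t B₂)) (h₂c : BigO ε 0 0 (slowTimeFamily ε t C₂))
    (h₀ : BigO ε 0 0 (slowTimeFamily ε t B₀)) :
    BigO ε n 0 (ansatz χ ε t B₁ C₁ B₂ C₂ B₀) := by
  have hd := fun {B : ℝ → ℝ → ℂ} (hB : BigO ε 0 0 (slowTimeFamily ε t B)) (m : ℤ) =>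
    BigO.harmonic (n := n) hχ hε hε₀ hB le_rfl m
  refine BigO.add ?_ (BigO.param_pow_mul hε hε₀
    (((hd h₂ 2).add (hd h₂c (-2))).add (hd h₀ 0)) 2 (by norm_num))
  simpa using BigO.param_pow_mul hε hε₀ (p' := 0) ((hd h₁ 1).add (hd h₁c (-1))) 1 (by norm_num)

end residual

/-! ### Decomposition of the residual into noncritical harmonics and a small rest. -/

section decomposition

variable {ι : Type*} {ε t : ι → ℝ} {ε₀ Tstar : ℝ} {χ : ℝ → ℝ} {A A' C₁' B₂' C₂' B₀' : ℝ → ℝ → ℂ}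
  {Q K : SignedMeasure ℝ}

/-- The residual of the approximation as a polynomial in families. -/
lemma approximationResidual_eq (hχ : IsModeCutoff {0} χ) (hε : ∀ i, 0 < ε i)
    (hε₀ : ∀ i, ε i ≤ ε₀) (hT : 0 < Tstar)
    (ht : ∀ i, t i ∈ Icc 0 (Tstar / ε i ^ 2)) (h₁ : IsAmplitude Tstar A A')
    (h₁c : IsAmplitude Tstar (conjAmplitude A) C₁')
    (h₂ : IsAmplitude Tstar (secondAmplitude Q A) B₂')
    (h₂c : IsAmplitude Tstar (conjAmplitude (secondAmplitude Q A)) C₂')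
    (h₀ : IsAmplitude Tstar (meanAmplitude Q A) B₀')
    {μ ν : Measure ℝ} {q k : ℝ → ℂ}
    (hq : ∀ M f, CkBound 0 M f → measureConv Q f = kernelConv μ q f)
    (hk : ∀ M f, CkBound 0 M f → measureConv K f = kernelConv ν k f)
    {φ : ι → ℝ → ℂ} (hφ : φ = ansatz χ ε t A (conjAmplitude A)
      (secondAmplitude Q A) (conjAmplitude (secondAmplitude Q A)) (meanAmplitude Q A)) :
    (fun i => approximationResidual Q K χ Tstar (ε i) A (t i)) =
      -(paramFamily ε ^ 2 * ansatz χ ε t A' C₁' B₂' C₂' B₀')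
      - (paramFamily ε * (harmonicSq χ ε t A 1 + harmonicSq χ ε t (conjAmplitude A) (-1))
        + paramFamily ε ^ 2 * (harmonicSq χ ε t (secondAmplitude Q A) 2
          + harmonicSq χ ε t (conjAmplitude (secondAmplitude Q A)) (-2)
          + harmonicSq χ ε t (meanAmplitude Q A) 0))
      + paramFamily ε ^ 2 * φ - φ * convFamily μ q φ - φ * convFamily ν k (φ * φ) := by
  have hle {B B' : ℝ → ℝ → ℂ} (hB : IsAmplitude Tstar B B') :
      BigO ε 0 0 (slowTimeFamily ε t B) := (hB.bigO hε ht).of_le (by norm_num)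
  have hφb : BigO ε 0 0 φ := hφ ▸ BigO.ansatz hχ hε hε₀ 0 (hle h₁) (hle h₁c) (hle h₂) (hle h₂c)
    (hle h₀)
  obtain ⟨C, -, hC⟩ := hφb
  ext i x
  have heq : refinedApproximation Q χ (ε i) A (t i) = φ i := by
    rw [hφ, refinedApproximation_eq_ansatz]
  -- A nondegenerate time interval makes the one-sided derivative at the end points well determined.
  have hI : UniqueDiffWithinAt ℝ (Icc 0 (Tstar / ε i ^ 2)) (t i) :=
    uniqueDiffOn_Icc (div_pos hT (pow_pos (hε i) 2)) _ (ht i)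
  rw [approximationResidual, residual,
    (hasDerivWithinAt_refinedApproximation hχ hε ht h₁ h₁c h₂ h₂c h₀ i x).derivWithin hI, heq,
    HasOnePlusDxxSq.linearPart_eq (hφ ▸ hasOnePlusDxxSq_ansatz hχ hε hε₀ (h₁.bigO hε ht)
      (h₁c.bigO hε ht) (h₂.bigO hε ht) (h₂c.bigO hε ht) (h₀.bigO hε ht) i) (ε i) x,
    nonlinearPart, hq _ _ (hC i),
    show (fun y => φ i y ^ 2) = φ i * φ i from funext fun y => pow_two _,
    hk _ _ ((hC i).mul (hC i))]
  simp only [Pi.add_apply, Pi.sub_apply, Pi.neg_apply, Pi.mul_apply, Pi.pow_apply, paramFamily,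
    convFamily]
  ring

lemma IsAmplitude.exists_secondAmplitude (h : IsAmplitude Tstar A A') (Q : SignedMeasure ℝ) :
    ∃ B', IsAmplitude Tstar (secondAmplitude Q A) B' := by
  have h1 : secondAmplitude Q A = fun T X => -(fourierCoefficient Q 1 / 9) * (A * A) T X := by
    ext T X
    simp only [secondAmplitude, secondHarmonic, Pi.mul_apply]
    ring
  rw [h1]
  exact ⟨_, (h.mul h).const_mul _⟩

lemma IsAmplitude.exists_meanAmplitude (h : IsAmplitude Tstar A A') (Q : SignedMeasure ℝ) :
    ∃ B', IsAmplitude Tstar (meanAmplitude Q A) B' := by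
  have h1 : meanAmplitude Q A =
      fun T X => -2 * fourierCoefficient Q 1 * (A * conjAmplitude A) T X := by
    ext T X
    simp only [meanAmplitude, meanMode, Pi.mul_apply, conjAmplitude, Complex.mul_conj']
  rw [h1]
  exact ⟨_, (h.mul h.comp_conj).const_mul _⟩

lemma iteratedDeriv_two_conj (f : ℝ → ℂ) :
    iteratedDeriv 2 (fun X => conj (f X)) = fun X => conj (iteratedDeriv 2 f X) := by
  simp only [iteratedDeriv_succ, iteratedDeriv_zero, starRingEnd_apply, deriv.star']

/-- The residual consists of harmonics of size `O(ε³)` which are annihilated by the filter around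
`±1`, and of a rest of size `O(ε⁴)`. -/
theorem residual_decomposition (hQ : IsAdmissibleKernel Q) (hK : IsAdmissibleKernel K)
    (hχ : IsModeCutoff {0} χ) (hε : ∀ i, 0 < ε i) (hε₀ : ∀ i, ε i ≤ ε₀) (hT : 0 < Tstar)
    (ht : ∀ i, t i ∈ Icc 0 (Tstar / ε i ^ 2)) (hA : IsGinzburgLandauSolution Q K Tstar A) :
    ∃ H₂ H₂' H₀ H₃ H₃' W : ι → ℝ → ℂ,
      (fun i => approximationResidual Q K χ Tstar (ε i) A (t i)) =
        H₂ + H₂' + H₀ + H₃ + H₃' + W ∧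
      BandLimitedFamily 2 3 H₂ ∧ BandLimitedFamily (-2) 3 H₂' ∧ BandLimitedFamily 0 3 H₀ ∧
      BandLimitedFamily 3 3 H₃ ∧ BandLimitedFamily (-3) 3 H₃' ∧
      BigO ε 1 3 (H₂ + H₂' + H₀ + H₃ + H₃') ∧ BigO ε 1 4 W := by
  obtain ⟨q, hq, hq1, hqc, hqf, hqe, hqr⟩ := hQ.exists_density
  obtain ⟨k, hk, hk1, hkc, hkf, hke, hkr⟩ := hK.exists_density
  set μ := Q.totalVariation
  set ν := K.totalVariation
  set c := cubicCoefficient Q K with hc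
  -- A real cubic coefficient lets the conjugate amplitude solve the same equation, so the harmonic
  -- `-1` cancels like the harmonic `1`.
  have hcr : conj c = c := by
    simp only [hc, cubicCoefficient, map_sub, map_add, map_mul, map_div₀, map_pow, hqr, hkr,
      map_ofNat]
  set A' := ginzburgLandauRHS c A with hA'
  have h₁ : IsAmplitude Tstar A A' := hA.isAmplitude
  have h₁c : IsAmplitude Tstar (conjAmplitude A) (conjAmplitude A') := h₁.comp_conj
  obtain ⟨B₂', h₂⟩ := h₁.exists_secondAmplitude Q
  have h₂c : IsAmplitude Tstar (conjAmplitude (secondAmplitude Q A)) (conjAmplitude B₂') :=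
    h₂.comp_conj
  obtain ⟨B₀', h₀⟩ := h₁.exists_meanAmplitude Q
  have hres := approximationResidual_eq hχ hε hε₀ hT ht h₁ h₁c h₂ h₂c h₀ hqc hkc rfl
  have hO {B B' : ℝ → ℝ → ℂ} (hB : IsAmplitude Tstar B B') (j : ℕ) (hj : j ≤ 4) (m : ℤ) :
      BigO ε 1 0 (harmonic χ ε t B j m) := BigO.harmonic hχ hε hε₀ (hB.bigO hε ht) hj m
  have hO' {B B' : ℝ → ℝ → ℂ} (hB : IsAmplitude Tstar B B') (m : ℤ) :
      BigO ε 1 0 (harmonic χ ε t B' 0 m) :=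
    BigO.harmonic hχ hε hε₀ (hB.bigO_deriv hε ht) (by norm_num) m
  have hM {B B' : ℝ → ℝ → ℂ} (hB : IsAmplitude Tstar B B') (j : ℕ) (hj : j + 1 ≤ 4) (m : ℤ) :
      Modulates ε m (harmonic χ ε t B j m) (slowAmplitude ε t B j) :=
    modulates_envelope hχ hε hε₀ (hB.bigO hε ht) hj m
  have hM' {B B' : ℝ → ℝ → ℂ} (hB : IsAmplitude Tstar B B') (m : ℤ) :
      Modulates ε m (harmonic χ ε t B' 0 m) (slowAmplitude ε t B' 0) :=
    modulates_envelope hχ hε hε₀ (hB.bigO_deriv hε ht) (by norm_num) m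
  have hBL {B B' : ℝ → ℝ → ℂ} (hB : IsAmplitude Tstar B B') (m : ℤ) :
      BandLimitedFamily m 1 (harmonic χ ε t B 0 m) :=
    BandLimitedFamily.harmonic hχ hε hε₀ (hB.bigO hε ht) (by norm_num) m
  have hS {B B' : ℝ → ℝ → ℂ} (hB : IsAmplitude Tstar B B') (m : ℤ) :
      BigO ε 1 0 (harmonicSqRem χ ε t B m) :=
    bigO_harmonicSqRem hχ hε hε₀ (hB.bigO hε ht) 1 m
  have hSB {B B' : ℝ → ℝ → ℂ} (hB : IsAmplitude Tstar B B') (m : ℤ) :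
      BandLimitedFamily m 1 (harmonicSqRem χ ε t B m) :=
    bandLimitedFamily_harmonicSqRem hχ hε hε₀ (hB.bigO hε ht) m
  have hQM {m : ℤ} {F u : ι → ℝ → ℂ} (hF : Modulates ε m F u) :
      Modulates ε m (convFamily μ q F) (constFamily (fourierCoefficient Q m) * u) := by
    rw [hqf]; exact hF.conv hq hq1 hε hε₀
  have hKM {m : ℤ} {F u : ι → ℝ → ℂ} (hF : Modulates ε m F u) :
      Modulates ε m (convFamily ν k F) (constFamily (fourierCoefficient K m) * u) := by
    rw [hkf]; exact hF.conv hk hk1 hε hε₀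
  rw [ansatz, ansatz, harmonicSq_eq_of_sq_eq_one (by norm_num),
    harmonicSq_eq_of_sq_eq_one (by norm_num), harmonicSq_eq 2, harmonicSq_eq (-2),
    harmonicSq_eq 0] at hres
  set e : ι → ℝ → ℂ := paramFamily ε with he
  -- `P`, `N` and `Z` denote the positive, negative and zero harmonics of the ansatz; `D₁`, `E₁`
  -- carry second space derivatives and `T₁`, `U₁` time derivatives. The residual becomes a
  -- polynomial in such families and their convolutions.
  obtain ⟨P₁, hP₁⟩ : ∃ F, F = harmonic χ ε t A 0 1 := ⟨_, rfl⟩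
  obtain ⟨N₁, hN₁⟩ : ∃ F, F = harmonic χ ε t (conjAmplitude A) 0 (-1) := ⟨_, rfl⟩
  obtain ⟨P₂, hP₂⟩ : ∃ F, F = harmonic χ ε t (secondAmplitude Q A) 0 2 := ⟨_, rfl⟩
  obtain ⟨N₂, hN₂⟩ : ∃ F, F = harmonic χ ε t (conjAmplitude (secondAmplitude Q A)) 0 (-2) :=
    ⟨_, rfl⟩
  obtain ⟨Z, hZ⟩ : ∃ F, F = harmonic χ ε t (meanAmplitude Q A) 0 0 := ⟨_, rfl⟩
  obtain ⟨D₁, hD₁⟩ : ∃ F, F = harmonic χ ε t A 2 1 := ⟨_, rfl⟩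
  obtain ⟨E₁, hE₁⟩ : ∃ F, F = harmonic χ ε t (conjAmplitude A) 2 (-1) := ⟨_, rfl⟩
  obtain ⟨T₁, hT₁⟩ : ∃ F, F = harmonic χ ε t A' 0 1 := ⟨_, rfl⟩
  obtain ⟨U₁, hU₁⟩ : ∃ F, F = harmonic χ ε t (conjAmplitude A') 0 (-1) := ⟨_, rfl⟩
  rw [← hP₁, ← hN₁, ← hP₂, ← hN₂, ← hZ, ← hD₁, ← hE₁, ← hT₁, ← hU₁] at hres
  have oP₁ : BigO ε 1 0 P₁ := hP₁ ▸ hO h₁ 0 (by norm_num) 1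
  have oN₁ : BigO ε 1 0 N₁ := hN₁ ▸ hO h₁c 0 (by norm_num) (-1)
  have oP₂ : BigO ε 1 0 P₂ := hP₂ ▸ hO h₂ 0 (by norm_num) 2
  have oN₂ : BigO ε 1 0 N₂ := hN₂ ▸ hO h₂c 0 (by norm_num) (-2)
  have oZ : BigO ε 1 0 Z := hZ ▸ hO h₀ 0 (by norm_num) 0
  have mP₁ : Modulates ε 1 P₁ _ := hP₁ ▸ hM h₁ 0 (by norm_num) 1
  have mN₁ : Modulates ε (-1) N₁ _ := hN₁ ▸ hM h₁c 0 (by norm_num) (-1)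
  have mP₂ : Modulates ε 2 P₂ _ := hP₂ ▸ hM h₂ 0 (by norm_num) 2
  have mN₂ : Modulates ε (-2) N₂ _ := hN₂ ▸ hM h₂c 0 (by norm_num) (-2)
  have mZ : Modulates ε 0 Z _ := hZ ▸ hM h₀ 0 (by norm_num) 0
  have mD₁ : Modulates ε 1 D₁ _ := hD₁ ▸ hM h₁ 2 (by norm_num) 1
  have mE₁ : Modulates ε (-1) E₁ _ := hE₁ ▸ hM h₁c 2 (by norm_num) (-1)
  have mT₁ : Modulates ε 1 T₁ _ := hT₁ ▸ hM' h₁ 1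
  have mU₁ : Modulates ε (-1) U₁ _ := hU₁ ▸ hM' h₁c (-1)
  have bP₁ : BandLimitedFamily 1 1 P₁ := hP₁ ▸ hBL h₁ 1
  have bN₁ : BandLimitedFamily (-1) 1 N₁ := hN₁ ▸ hBL h₁c (-1)
  have bP₂ : BandLimitedFamily 2 1 P₂ := hP₂ ▸ hBL h₂ 2
  have bN₂ : BandLimitedFamily (-2) 1 N₂ := hN₂ ▸ hBL h₂c (-2)
  have bZ : BandLimitedFamily 0 1 Z := hZ ▸ hBL h₀ 0
  clear hP₁ hN₁ hP₂ hN₂ hZ hD₁ hE₁ hT₁ hU₁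
  have oS₂ := hS h₂ 2
  have oS₂' := hS h₂c (-2)
  have oS₀ := hS h₀ 0
  have bS₂ := hSB h₂ 2
  have bS₂' := hSB h₂c (-2)
  have bS₀ := hSB h₀ 0
  have oR {B B' : ℝ → ℝ → ℂ} (hB : IsAmplitude Tstar B B') (m : ℤ) :
      BigO ε 1 0 (e * harmonic χ ε t B 4 m
        + constFamily (4 * Complex.I * m) * harmonic χ ε t B 3 m) := by
    refine BigO.add ?_ ((hO hB 3 (by norm_num) m).const_mul _)
    simpa using (hO hB 4 (by norm_num) m).param_pow_mul hε hε₀ 1 (p' := 0) (by norm_num)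
  have oR₁ := oR h₁ 1
  have oR₁' := oR h₁c (-1)
  have oT₂ := hO' h₂ 2
  have oT₂' := hO' h₂c (-2)
  have oT₀ := hO' h₀ 0
  generalize harmonicSqRem χ ε t (secondAmplitude Q A) 2 = S₂ at *
  generalize harmonicSqRem χ ε t (conjAmplitude (secondAmplitude Q A)) (-2) = S₂' at *
  generalize harmonicSqRem χ ε t (meanAmplitude Q A) 0 = S₀ at *
  generalize e * harmonic χ ε t A 4 1
    + constFamily (4 * Complex.I * (1 : ℤ)) * harmonic χ ε t A 3 1 = R₁ at *
  generalize e * harmonic χ ε t (conjAmplitude A) 4 (-1)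
    + constFamily (4 * Complex.I * (-1 : ℤ)) * harmonic χ ε t (conjAmplitude A) 3 (-1) = R₁' at *
  generalize harmonic χ ε t B₂' 0 2 = T₂ at *
  generalize harmonic χ ε t (conjAmplitude B₂') 0 (-2) = T₂' at *
  generalize harmonic χ ε t B₀' 0 0 = T₀ at *
  have cQ {p p' : ℕ} {F G : ι → ℝ → ℂ} (hF : BigO ε 1 p F) (hG : BigO ε 1 p' G) :
      convFamily μ q (F + G) = convFamily μ q F + convFamily μ q G :=
    convFamily_add hq (hF.of_le zero_le_one) (hG.of_le zero_le_one)
  have cK {p p' : ℕ} {F G : ι → ℝ → ℂ} (hF : BigO ε 1 p F) (hG : BigO ε 1 p' G) :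
      convFamily ν k (F + G) = convFamily ν k F + convFamily ν k G :=
    convFamily_add hk (hF.of_le zero_le_one) (hG.of_le zero_le_one)
  have oe (n : ℕ) {F : ι → ℝ → ℂ} (hF : BigO ε 1 0 F) : BigO ε 1 n (e ^ n * F) :=
    hF.param_pow_mul hε hε₀ n (by simp)
  obtain ⟨ψ₁, hψ₁⟩ : ∃ F, F = P₁ + N₁ := ⟨_, rfl⟩
  obtain ⟨ψ₂, hψ₂⟩ : ∃ F, F = P₂ + N₂ + Z := ⟨_, rfl⟩
  have oψ₁ : BigO ε 1 0 ψ₁ := hψ₁ ▸ oP₁.add oN₁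
  have oψ₂ : BigO ε 1 0 ψ₂ := hψ₂ ▸ (oP₂.add oN₂).add oZ
  have o11 : BigO ε 1 0 (ψ₁ * ψ₁) := oψ₁.mul oψ₁
  have o12 : BigO ε 1 0 (ψ₁ * ψ₂ + ψ₁ * ψ₂) := (oψ₁.mul oψ₂).add (oψ₁.mul oψ₂)
  have o22 : BigO ε 1 0 (ψ₂ * ψ₂) := oψ₂.mul oψ₂
  have hCQ : convFamily μ q (e * ψ₁ + e ^ 2 * ψ₂) =
      e * convFamily μ q ψ₁ + e ^ 2 * convFamily μ q ψ₂ := by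
    rw [cQ (by simpa using oe 1 oψ₁) (oe 2 oψ₂), convFamily_param_mul, convFamily_param_pow_mul]
  have hCK : convFamily ν k ((e * ψ₁ + e ^ 2 * ψ₂) * (e * ψ₁ + e ^ 2 * ψ₂)) =
      e ^ 2 * convFamily ν k (ψ₁ * ψ₁) + e ^ 3 * convFamily ν k (ψ₁ * ψ₂ + ψ₁ * ψ₂)
        + e ^ 4 * convFamily ν k (ψ₂ * ψ₂) := by
    rw [show (e * ψ₁ + e ^ 2 * ψ₂) * (e * ψ₁ + e ^ 2 * ψ₂) = e ^ 2 * (ψ₁ * ψ₁) +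
      e ^ 3 * (ψ₁ * ψ₂ + ψ₁ * ψ₂) + e ^ 4 * (ψ₂ * ψ₂) by ring,
      cK (((oe 2 o11).of_pow_le hε hε₀ (Nat.zero_le _)).add
        ((oe 3 o12).of_pow_le hε hε₀ (Nat.zero_le _))) (oe 4 o22), cK (oe 2 o11) (oe 3 o12),
      convFamily_param_pow_mul, convFamily_param_pow_mul, convFamily_param_pow_mul]
  have hQ1 : convFamily μ q ψ₁ = convFamily μ q P₁ + convFamily μ q N₁ := by
    rw [hψ₁, cQ oP₁ oN₁]
  have hQ2 : convFamily μ q ψ₂ = convFamily μ q P₂ + convFamily μ q N₂ + convFamily μ q Z := by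
    rw [hψ₂, cQ (oP₂.add oN₂) oZ, cQ oP₂ oN₂]
  have oPN : BigO ε 1 0 (P₁ * N₁) := oP₁.mul oN₁
  have hK11 : convFamily ν k (ψ₁ * ψ₁) = convFamily ν k (P₁ * P₁) +
      (convFamily ν k (P₁ * N₁) + convFamily ν k (P₁ * N₁)) + convFamily ν k (N₁ * N₁) := by
    rw [hψ₁, show (P₁ + N₁) * (P₁ + N₁) = P₁ * P₁ + (P₁ * N₁ + P₁ * N₁) + N₁ * N₁ by ring,
      cK ((oP₁.mul oP₁).add (oPN.add oPN)) (oN₁.mul oN₁), cK (oP₁.mul oP₁) (oPN.add oPN),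
      cK oPN oPN]
  have oQψ₁ := oψ₁.conv hq
  have oQψ₂ := oψ₂.conv hq
  have oK11 := o11.conv hk
  have oK12 := o12.conv hk
  have oK22 := o22.conv hk
  rw [← hψ₁, ← hψ₂, hCQ, hCK] at hres
  clear hCQ hCK
  have mul {m m' l : ℤ} {F G u v : ι → ℝ → ℂ} (hF : Modulates ε m F u) (hG : Modulates ε m' G v)
    (hl : m + m' = l) : Modulates ε l (F * G) (u * v) := hF.mul hε hε₀ hG hl
  -- Leading amplitude at `e^{2ix}`: `-9 A₂ - q₁ A² = 0`.
  have zP₂ : BigO ε 1 1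
      (-(constFamily ((1 - ((2 : ℤ) : ℂ) ^ 2) ^ 2) * P₂) - P₁ * convFamily μ q P₁) := by
    refine (((mP₂.const_mul _).neg).sub (mul mP₁ (hQM mP₁) (by norm_num))).bigO ?_
    ext i x
    simp only [Pi.sub_apply, Pi.neg_apply, Pi.mul_apply, Pi.zero_apply, constFamily,
      slowAmplitude, scaleFamily, slowTimeFamily, iteratedDeriv_zero, secondAmplitude,
      secondHarmonic]
    push_cast
    ring
  have zN₂ : BigO ε 1 1
      (-(constFamily ((1 - ((-2 : ℤ) : ℂ) ^ 2) ^ 2) * N₂) - N₁ * convFamily μ q N₁) := by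
    refine (((mN₂.const_mul _).neg).sub (mul mN₁ (hQM mN₁) (by norm_num))).bigO ?_
    ext i x
    simp only [Pi.sub_apply, Pi.neg_apply, Pi.mul_apply, Pi.zero_apply, constFamily,
      slowAmplitude, scaleFamily, slowTimeFamily, iteratedDeriv_zero, secondAmplitude,
      secondHarmonic, conjAmplitude, map_neg, map_mul, map_div₀, map_pow, hqr, hqe, map_ofNat]
    push_cast
    ring
  -- Leading amplitude of the mean mode: `-A₀ - (q₋₁ + q₁) |A|² = 0`, by evenness of the
  -- coefficients.
  have zZ : BigO ε 1 1
      (-(constFamily ((1 - ((0 : ℤ) : ℂ) ^ 2) ^ 2) * Z) - P₁ * convFamily μ q N₁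
        - N₁ * convFamily μ q P₁) := by
    refine ((((mZ.const_mul _).neg).sub (mul mP₁ (hQM mN₁) (by norm_num))).sub
      (mul mN₁ (hQM mP₁) (by norm_num))).bigO ?_
    ext i x
    simp only [Pi.sub_apply, Pi.neg_apply, Pi.mul_apply, Pi.zero_apply, constFamily,
      slowAmplitude, scaleFamily, slowTimeFamily, iteratedDeriv_zero, meanAmplitude,
      meanMode, conjAmplitude, hqe, ← Complex.mul_conj']
    push_cast
    ring
  have mPN := hKM (mul mP₁ mN₁ (by norm_num : (1 : ℤ) + -1 = 0))
  have mPP := hKM (mul mP₁ mP₁ (by norm_num : (1 : ℤ) + 1 = 2))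
  have mNN := hKM (mul mN₁ mN₁ (by norm_num : (-1 : ℤ) + -1 = -2))
  -- All contributions of order `ε³` at wave number `1`: the quadratic term couples `1 + 0` and `2 -
  -- 1`, the cubic one `1 + (1 - 1)`, counted twice, and `-1 + (1 + 1)`.
  obtain ⟨X₁, hX₁⟩ : ∃ F, F = -T₁ - constFamily (-4) * D₁ + P₁ - P₁ * convFamily μ q Z
      - Z * convFamily μ q P₁ - N₁ * convFamily μ q P₂ - P₂ * convFamily μ q N₁
      - P₁ * convFamily ν k (P₁ * N₁) - P₁ * convFamily ν k (P₁ * N₁)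
      - N₁ * convFamily ν k (P₁ * P₁) := ⟨_, rfl⟩
  obtain ⟨Y₁, hY₁⟩ : ∃ F, F = -U₁ - constFamily (-4) * E₁ + N₁ - N₁ * convFamily μ q Z
      - Z * convFamily μ q N₁ - P₁ * convFamily μ q N₂ - N₂ * convFamily μ q P₁
      - N₁ * convFamily ν k (P₁ * N₁) - N₁ * convFamily ν k (P₁ * N₁)
      - P₁ * convFamily ν k (N₁ * N₁) := ⟨_, rfl⟩
  have zX₁ : BigO ε 1 1 X₁ := by
    rw [hX₁]
    refine (((((((((mT₁.neg.sub (mD₁.const_mul _)).add mP₁).sub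
      (mul mP₁ (hQM mZ) (by norm_num))).sub (mul mZ (hQM mP₁) (by norm_num))).sub
      (mul mN₁ (hQM mP₂) (by norm_num))).sub (mul mP₂ (hQM mN₁) (by norm_num))).sub
      (mul mP₁ mPN (by norm_num))).sub (mul mP₁ mPN (by norm_num))).sub
      (mul mN₁ mPP (by norm_num))).bigO ?_
    -- Inserting `A₂` and `A₀` turns the quadratic interactions into multiples of `|A|² A`; with the
    -- `K` terms they sum exactly to the cubic term of the Ginzburg-Landau equation.
    ext i x
    simp only [Pi.add_apply, Pi.sub_apply, Pi.neg_apply, Pi.mul_apply, Pi.zero_apply, constFamily,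
      slowAmplitude, scaleFamily, slowTimeFamily, iteratedDeriv_zero, secondAmplitude,
      secondHarmonic, meanAmplitude, meanMode, conjAmplitude, hqe, hA', ginzburgLandauRHS,
      hc, cubicCoefficient, ← Complex.mul_conj']
    ring
  have zY₁ : BigO ε 1 1 Y₁ := by
    rw [hY₁]
    refine (((((((((mU₁.neg.sub (mE₁.const_mul _)).add mN₁).sub
      (mul mN₁ (hQM mZ) (by norm_num))).sub (mul mZ (hQM mN₁) (by norm_num))).sub
      (mul mP₁ (hQM mN₂) (by norm_num))).sub (mul mN₂ (hQM mP₁) (by norm_num))).sub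
      (mul mN₁ mPN (by norm_num))).sub (mul mN₁ mPN (by norm_num))).sub
      (mul mP₁ mNN (by norm_num))).bigO ?_
    ext i x
    have h2 : iteratedDeriv 2 (conjAmplitude A (ε i ^ 2 * t i)) =
        fun X => conj (iteratedDeriv 2 (A (ε i ^ 2 * t i)) X) := iteratedDeriv_two_conj _
    simp only [Pi.add_apply, Pi.sub_apply, Pi.neg_apply, Pi.mul_apply, Pi.zero_apply, constFamily,
      slowAmplitude, scaleFamily, slowTimeFamily, iteratedDeriv_zero, h2]
    simp only [secondAmplitude,
      secondHarmonic, meanAmplitude, meanMode, conjAmplitude, hqe, hke, hA', ginzburgLandauRHS,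
      map_neg, map_mul, map_div₀, map_pow, map_add, map_sub, hqr, hcr, map_ofNat,
      ← Complex.mul_conj', Complex.conj_conj]
    simp only [hc, cubicCoefficient]
    ring
  -- The corrections `e * S` stay with their harmonics: they are only `O(ε³)` in total, so they must
  -- remain visible to the spectral argument. The critical part `X₁ + Y₁` goes into the rest, having
  -- gained its extra power of `ε`.
  refine ⟨e ^ 2 * (-(constFamily ((1 - ((2 : ℤ) : ℂ) ^ 2) ^ 2) * P₂) - P₁ * convFamily μ q P₁
      - e * S₂),
    e ^ 2 * (-(constFamily ((1 - ((-2 : ℤ) : ℂ) ^ 2) ^ 2) * N₂) - N₁ * convFamily μ q N₁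
      - e * S₂'),
    e ^ 2 * (-(constFamily ((1 - ((0 : ℤ) : ℂ) ^ 2) ^ 2) * Z) - P₁ * convFamily μ q N₁
      - N₁ * convFamily μ q P₁ - e * S₀),
    e ^ 3 * (-(P₁ * convFamily μ q P₂) - P₂ * convFamily μ q P₁ - P₁ * convFamily ν k (P₁ * P₁)),
    e ^ 3 * (-(N₁ * convFamily μ q N₂) - N₂ * convFamily μ q N₁ - N₁ * convFamily ν k (N₁ * N₁)),
    e ^ 3 * (X₁ + Y₁) + e ^ 4 * (-(T₂ + T₂' + T₀) - (R₁ + R₁') + ψ₂ - ψ₂ * convFamily μ q ψ₂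
      - (ψ₁ * convFamily ν k (ψ₁ * ψ₂ + ψ₁ * ψ₂) + ψ₂ * convFamily ν k (ψ₁ * ψ₁))
      - e * (ψ₁ * convFamily ν k (ψ₂ * ψ₂) + ψ₂ * convFamily ν k (ψ₁ * ψ₂ + ψ₁ * ψ₂))
      - e ^ 2 * (ψ₂ * convFamily ν k (ψ₂ * ψ₂))), ?_, ?_, ?_, ?_, ?_, ?_, ?_, ?_⟩
  · rw [hres, hX₁, hY₁, hQ1, hQ2, hK11]
    generalize convFamily ν k (ψ₁ * ψ₂ + ψ₁ * ψ₂) = K12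
    generalize convFamily ν k (ψ₂ * ψ₂) = K22
    rw [hψ₁, hψ₂]
    ring
  · exact bandLimitedFamily_param_pow_mul ((((bP₂.const_mul _).neg.of_le (by norm_num)).sub
      ((bP₁.mul (bP₁.conv hq) (by norm_num)).of_le (by norm_num))).sub
      ((bS₂.param_mul ε).of_le (by norm_num))) 2
  · exact bandLimitedFamily_param_pow_mul ((((bN₂.const_mul _).neg.of_le (by norm_num)).sub
      ((bN₁.mul (bN₁.conv hq) (by norm_num)).of_le (by norm_num))).sub
      ((bS₂'.param_mul ε).of_le (by norm_num))) 2
  · exact bandLimitedFamily_param_pow_mul (((((bZ.const_mul _).neg.of_le (by norm_num)).sub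
      ((bP₁.mul (bN₁.conv hq) (by norm_num)).of_le (by norm_num))).sub
      ((bN₁.mul (bP₁.conv hq) (by norm_num)).of_le (by norm_num))).sub
      ((bS₀.param_mul ε).of_le (by norm_num))) 2
  · exact bandLimitedFamily_param_pow_mul ((((bP₁.mul (bP₂.conv hq) (by norm_num)).neg.of_le
      (by norm_num)).sub ((bP₂.mul (bP₁.conv hq) (by norm_num)).of_le (by norm_num))).sub
      (bP₁.mul ((bP₁.mul bP₁ rfl).conv hk) (by norm_num))) 3
  · exact bandLimitedFamily_param_pow_mul ((((bN₁.mul (bN₂.conv hq) (by norm_num)).neg.of_le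
      (by norm_num)).sub ((bN₂.mul (bN₁.conv hq) (by norm_num)).of_le (by norm_num))).sub
      (bN₁.mul ((bN₁.mul bN₁ rfl).conv hk) (by norm_num))) 3
  · have o1 {F : ι → ℝ → ℂ} (hF : BigO ε 1 0 F) : BigO ε 1 1 (e * F) := by simpa using oe 1 hF
    have o2 {F : ι → ℝ → ℂ} (hF : BigO ε 1 1 F) : BigO ε 1 3 (e ^ 2 * F) :=
      hF.param_pow_mul hε hε₀ 2 le_rfl
    exact ((((o2 (zP₂.sub (o1 oS₂))).add (o2 (zN₂.sub (o1 oS₂')))).add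
      (o2 (zZ.sub (o1 oS₀)))).add (oe 3 (((oP₁.mul (oP₂.conv hq)).neg.sub
      (oP₂.mul (oP₁.conv hq))).sub (oP₁.mul ((oP₁.mul oP₁).conv hk))))).add
      (oe 3 (((oN₁.mul (oN₂.conv hq)).neg.sub
      (oN₂.mul (oN₁.conv hq))).sub (oN₁.mul ((oN₁.mul oN₁).conv hk))))
  · have o1 {F : ι → ℝ → ℂ} (hF : BigO ε 1 0 F) : BigO ε 1 0 (e * F) := by
      simpa using hF.param_pow_mul hε hε₀ 1 (p' := 0) (by norm_num)
    have o2 {F : ι → ℝ → ℂ} (hF : BigO ε 1 0 F) : BigO ε 1 0 (e ^ 2 * F) :=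
      hF.param_pow_mul hε hε₀ 2 (by norm_num)
    exact ((zX₁.add zY₁).param_pow_mul hε hε₀ 3 (by norm_num)).add (oe 4
      (((((((oT₂.add oT₂').add oT₀).neg.sub (oR₁.add oR₁')).add oψ₂).sub (oψ₂.mul oQψ₂)).sub
      ((oψ₁.mul oK12).add (oψ₂.mul oK11))).sub (o1 ((oψ₁.mul oK22).add (oψ₂.mul oK12)))
      |>.sub (o2 (oψ₂.mul oK22))))


end decomposition

lemma cnorm_one_le_of_bigO {ι : Type*} {ε : ι → ℝ} {p : ℕ} {C : ℝ} {F : ι → ℝ → ℂ}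
    (h : ∀ i, CkBound 1 (C * ε i ^ p) (F i)) (i : ι) :
    cnorm 1 (F i) ≤ ENNReal.ofReal (2 * C * ε i ^ p) := by
  refine (h i).cnorm_le.trans (le_of_eq ?_)
  congr 1
  push_cast
  ring

end NonlocalSwiftHohenberg

end

theorem mainTheorem2
    (Q K : SignedMeasure ℝ) (hQ : IsAdmissibleKernel Q) (hK : IsAdmissibleKernel K)
    (χc χ₀ : ℝ → ℝ) (hχc : IsModeCutoff {-1, 1} χc) (hχ₀ : IsModeCutoff {0} χ₀)
    (Tstar : ℝ) (hT : 0 < Tstar)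
    (A : ℝ → ℝ → ℂ) (hA : IsGinzburgLandauSolution Q K Tstar A)
    (ε₀ : ℝ) (hε₀ : 0 < ε₀) :
    ∃ C : ℝ, 0 < C ∧ ∀ ε : ℝ, 0 < ε → ε ≤ ε₀ →
      (∀ t ∈ Icc 0 (Tstar / ε ^ 2),
        InCb 4 (refinedApproximation Q χ₀ ε A t) ∧
        (∀ x : ℝ, DifferentiableWithinAt ℝ (fun s => refinedApproximation Q χ₀ ε A s x)
          (Icc 0 (Tstar / ε ^ 2)) t) ∧
        InCb 1 (approximationResidual Q K χ₀ Tstar ε A t) ∧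
        InCb 1 (coFilter χc (approximationResidual Q K χ₀ Tstar ε A t)) ∧
        InCb 1 (modeFilter χc (approximationResidual Q K χ₀ Tstar ε A t))) ∧
      (⨆ t ∈ Icc 0 (Tstar / ε ^ 2),
          cnorm 1 (coFilter χc (approximationResidual Q K χ₀ Tstar ε A t)))
        ≤ ENNReal.ofReal (C * ε ^ 3) ∧
      (⨆ t ∈ Icc 0 (Tstar / ε ^ 2),
          cnorm 1 (modeFilter χc (approximationResidual Q K χ₀ Tstar ε A t)))
        ≤ ENNReal.ofReal (C * ε ^ 4) := by
  -- Indexing by all admissible pairs `(ε, t)` makes every constant uniform in both.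
  let ι := {p : ℝ × ℝ // 0 < p.1 ∧ p.1 ≤ ε₀ ∧ p.2 ∈ Icc 0 (Tstar / p.1 ^ 2)}
  let e : ι → ℝ := fun i => i.1.1
  let τ : ι → ℝ := fun i => i.1.2
  have he : ∀ i, 0 < e i := fun i => i.2.1
  have he₀ : ∀ i, e i ≤ ε₀ := fun i => i.2.2.1
  have hτ : ∀ i, τ i ∈ Icc 0 (Tstar / e i ^ 2) := fun i => i.2.2.2
  have h₁ := hA.isAmplitude
  have h₁c : IsAmplitude Tstar (conjAmplitude A) _ := h₁.comp_conj
  obtain ⟨B₂', h₂⟩ := h₁.exists_secondAmplitude Q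
  have h₂c : IsAmplitude Tstar (conjAmplitude (secondAmplitude Q A)) _ := h₂.comp_conj
  obtain ⟨B₀', h₀⟩ := h₁.exists_meanAmplitude Q
  have hle {B B' : ℝ → ℝ → ℂ} (hB : IsAmplitude Tstar B B') :
      BigO e 0 0 (slowTimeFamily e τ B) := (hB.bigO he hτ).of_le (by norm_num)
  obtain ⟨Cφ, -, hφ⟩ := BigO.ansatz hχ₀ he he₀ 4 (hle h₁) (hle h₁c) (hle h₂) (hle h₂c) (hle h₀)
  obtain ⟨H₂, H₂', H₀, H₃, H₃', W, hR, b₂, b₂', b₀, b₃, b₃', oH, oW⟩ :=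
    residual_decomposition hQ hK hχ₀ he he₀ hT hτ hA
  set R : ι → ℝ → ℂ := fun i => approximationResidual Q K χ₀ Tstar (e i) A (τ i)
  obtain ⟨G, hG, -⟩ := hχc.exists_schwartz
  have hGi : Integrable G := G.integrable
  have oR : BigO e 1 3 R := hR ▸ oH.add (oW.of_pow_le he he₀ (by norm_num))
  -- The harmonics are annihilated exactly, so no loss from their `O(ε³)` size enters the critical
  -- part.
  have hEH : convFamily volume G (H₂ + H₂' + H₀ + H₃ + H₃') = 0 := by
    have h0 {m : ℤ} {F : ι → ℝ → ℂ} (hF : BandLimitedFamily m 3 F) (h1 : m ≠ 1) (h2 : m ≠ -1)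
        (i : ι) : kernelConv volume G (F i) = 0 := by
      rw [← hG, ← modeFilter_eq_kernelConv]
      exact hF.modeFilter_eq_zero hχc le_rfl h1 h2 i
    funext i
    obtain ⟨M₂, m₂⟩ := (b₂ i).bounded
    obtain ⟨M₂', m₂'⟩ := (b₂' i).bounded
    obtain ⟨M₀, m₀⟩ := (b₀ i).bounded
    obtain ⟨M₃, m₃⟩ := (b₃ i).bounded
    obtain ⟨M₃', m₃'⟩ := (b₃' i).bounded
    change kernelConv volume G (H₂ i + H₂' i + H₀ i + H₃ i + H₃' i) = 0
    rw [kernelConv_add hGi (((m₂.add m₂').add m₀).add m₃) m₃',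
      kernelConv_add hGi ((m₂.add m₂').add m₀) m₃, kernelConv_add hGi (m₂.add m₂') m₀,
      kernelConv_add hGi m₂ m₂', h0 b₂ (by norm_num) (by norm_num),
      h0 b₂' (by norm_num) (by norm_num), h0 b₀ (by norm_num) (by norm_num),
      h0 b₃ (by norm_num) (by norm_num), h0 b₃' (by norm_num) (by norm_num)]
    simp
  have hER : convFamily volume G R = convFamily volume G W := by
    rw [hR, convFamily_add hGi (oH.of_le zero_le_one) (oW.of_le zero_le_one), hEH, zero_add]
  have hmode : ∀ i, modeFilter χc (R i) = convFamily volume G W i := fun i => by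
    rw [modeFilter_eq_kernelConv, hG, ← hER]
    rfl
  have oE : BigO e 1 4 (convFamily volume G W) := oW.conv hGi
  have oS : BigO e 1 3 (R - convFamily volume G W) := oR.sub (oE.of_pow_le he he₀ (by norm_num))
  have hco : ∀ i, coFilter χc (R i) = (R - convFamily volume G W) i := fun i => by
    ext x
    rw [coFilter, hmode]
    rfl
  obtain ⟨CR, -, hCR⟩ := oR
  obtain ⟨CE, hCE0, hCE⟩ := oE
  obtain ⟨CS, hCS0, hCS⟩ := oS
  -- The factors `2` come from the `C¹` norm adding the suprema of the function and its derivative;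
  -- the `1` ensures positivity.
  refine ⟨2 * CE + 2 * CS + 1, by positivity, fun ε hε hεε₀ => ⟨fun t ht => ?_, ?_, ?_⟩⟩
  · set i : ι := ⟨(ε, t), hε, hεε₀, ht⟩
    refine ⟨?_, fun x => (hasDerivWithinAt_refinedApproximation hχ₀ he hτ h₁ h₁c h₂ h₂c h₀ i
      x).differentiableWithinAt, (hCR i).inCb, ?_, ?_⟩
    · have := (hφ i).inCb
      rwa [← refinedApproximation_eq_ansatz] at this
    · have := (hCS i).inCb
      rwa [← hco] at this
    · have := (hCE i).inCb
      rwa [← hmode] at this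
  · refine iSup₂_le fun t ht => ?_
    set i : ι := ⟨(ε, t), hε, hεε₀, ht⟩
    have := cnorm_one_le_of_bigO hCS i
    rw [← hco] at this
    refine this.trans (ENNReal.ofReal_le_ofReal ?_)
    exact mul_le_mul_of_nonneg_right (by linarith) (by positivity)
  · refine iSup₂_le fun t ht => ?_
    set i : ι := ⟨(ε, t), hε, hεε₀, ht⟩
    have := cnorm_one_le_of_bigO hCE i
    rw [← hmode] at this
    refine this.trans (ENNReal.ofReal_le_ofReal ?_)
    exact mul_le_mul_of_nonneg_right (by linarith) (by positivity)
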